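/- Let $0<\alpha\le 1$, $M>0$, and let $\mathcal F_\alpha(M)$ be the set of symmetric $f:[0,1]^2\to[0,1]$ with $|f(x,y)-f(x',y')|\le M(|x-x'|+|y-y'|)^{\alpha}$ whenever $x\ge y$, $x'\ge y'$. A composite graphon model on the nodes $[n]$ with graphon $f$ and memory parameter $l\ge 0$ consists of i.i.d. $U(0,1)$ latent variables $\xi=(\xi_1,\dots,\xi_n)$, binary symmetric edge variables $A_{ij}$ ($i\ne j$), and an (unobserved) bijection $\omega$ from the set of unordered pairs of distinct nodes onto $\{1,\dots,N\}$, $N=n(n-1)/2$, such that, with $B_s=A_{\omega^{-1}(s)}$, $\mathbb P(A_{ij}=1\mid\xi)=f(\xi_i,\xi_j)$ for $i\neq j$ and $\mathbb P(B_s=1\mid B_{s-1},B_{s-2},\dots,B_1,\xi)=\mathbb P(B_s=1\mid B_{s-1},\dots,B_{s-l},\xi)$ for all $s$ (variables with non-positive index being omitted). Put $U_s=(B_s,\dots,B_{s-l+1})$, again restricted to positive indices, and assume that for some $\alpha'>0$, almost surely, $\mathbb P(U_s=u\mid U_{s-l},\xi)\ge\alpha'$ for all $1\le s\le N$ and all binary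 vectors $u$. The dependence parameter is $\chi=(1-2\alpha')^{1/l}$ if $l\ge1$, and $\chi=0$ if $l=0$. Both $\alpha'$ and $\chi$ may depend on $n$. Let $\theta_{ij}=f(\xi_i,\xi_j)$ for $i\ne j$ and $\theta_{ii}=0$. Let $(\hat Q,\hat z)$ be any minimizer of $\sum_{i<j}(A_{ij}-Q_{z(i)z(j)})^2$ over all symmetric $Q\in\mathbb R^{k\times k}$ and all $z:[n]\to[k]$ (chosen measurably), and set $\hat\theta_{ij}=\hat Q_{\hat z(i)\hat z(j)}$ for $i\neq j$, $\hat\theta_{ii}=0$. Theorem. Let the memory parameter be bounded, $l\le L$, and let $k\asymp n^{1/(1+\alpha\wedge1)}$, that is, $c_1n^{1/(1+\alpha\wedge 1)}\le k\le c_2n^{1/(1+\alpha\wedge 1)}$ with constants $c_1,c_2>0$. Then there are constants $C,C',C_1>0$, depending only on $\alpha,M,L,c_1,c_2$, such that for every $n\ge1$, every $f\in\mathcal F_\alpha(M)$ and every such model, $$\frac1{n^2}\sum_{i,j\in[n]}(\hat\theta_{ij}-\theta_{ij})^2\le C\,n^{-\frac{2(\alpha\wedge1)}{1+\alpha\wedge1}}(1-\chi)^{-2}\log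 n$$ with probability at least $1-\exp(-C'n)$, and $$\mathbb E\Big\{\frac1{n^2}\sum_{i,j\in[n]}(\hat\theta_{ij}-\theta_{ij})^2\Big\}\le C_1\,n^{-\frac{2(\alpha\wedge1)}{1+\alpha\wedge1}}(1-\chi)^{-2}\log n .$$ In particular the second bound holds for the supremum over $f\in\mathcal F_\alpha(M)$. -/

import Mathlib

open MeasureTheory ProbabilityTheory unitInterval

noncomputable section

/-- The symmetric functions on `[0,1]²` which are `α`-Hölder, with constant `M`, on the triangle
`{x ≥ y}`. -/
def holderClass (α M : ℝ) : Set (I → I → ℝ) :=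
  {f | (∀ x y, f x y = f y x) ∧
    ∀ x y x' y' : I, y ≤ x → y' ≤ x' →
      |f x y - f x' y'| ≤ M * (|(x : ℝ) - x'| + |(y : ℝ) - y'|) ^ α}

/-- The bounded Hölder class `F_α(M)`: the members of `holderClass α M` with values in `[0,1]`. -/
def boundedHolderClass (α M : ℝ) : Set (I → I → ℝ) :=
  {f | f ∈ holderClass α M ∧ ∀ x y, 0 ≤ f x y ∧ f x y ≤ 1}

/-- The unordered pairs `{i, j}` of distinct nodes. -/
abbrev NodePair (n : ℕ) : Type := {e : Sym2 (Fin n) // ¬ e.IsDiag}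

/-- The ordered edge variables `B_s = A_{ω⁻¹(s)}` (positions are counted from `0`). -/
def orderedEdge {Ω : Type*} {n : ℕ} (A : Sym2 (Fin n) → Ω → Bool)
    (ord : NodePair n ≃ Fin (n.choose 2)) (s : Fin (n.choose 2)) : Ω → Bool :=
  A (ord.symm s : Sym2 (Fin n))

/-- The σ-algebra generated by the latent variables. -/
abbrev latentSigma {Ω : Type*} {n : ℕ} (ξ : Fin n → Ω → I) : MeasurableSpace Ω :=
  ⨆ i, MeasurableSpace.comap (ξ i) inferInstance

/-- The σ-algebra generated by the latent variables and the ordered edge variables `B_s`,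
`s ∈ S`. -/
abbrev historySigma {Ω : Type*} {n N : ℕ} (ξ : Fin n → Ω → I) (B : Fin N → Ω → Bool)
    (S : Set (Fin N)) : MeasurableSpace Ω :=
  latentSigma ξ ⊔ ⨆ s ∈ S, MeasurableSpace.comap (B s) inferInstance

/-- The composite graphon model with graphon `f`: latent i.i.d. `U(0,1)` variables `ξ`, edge
variables `A` (only the values at pairs of distinct nodes matter), latent edge order `ord`, memory
parameter `l`, and a lower bound `α' > 0` on the `l`-step transition probabilities of the block
`U_s = (B_s, …, B_{s-l+1})`. Near the beginning of the sequence the blocks consist of those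
of their positions that exist. -/
structure IsCompositeGraphonModel {Ω : Type*} [MeasurableSpace Ω] (P : Measure Ω) {n : ℕ}
    (ξ : Fin n → Ω → I) (A : Sym2 (Fin n) → Ω → Bool) (ord : NodePair n ≃ Fin (n.choose 2))
    (l : ℕ) (α' : ℝ) (f : I → I → ℝ) : Prop where
  measurable_latent : ∀ i, Measurable (ξ i)
  indep_latent : iIndepFun ξ P
  uniform_latent : ∀ i, P.map (ξ i) = volume
  measurable_edge : ∀ e, Measurable (A e)
  /-- `P(A_{ij} = 1 | ξ) = f(ξ_i, ξ_j)` for `i ≠ j`. -/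
  marginal : ∀ i j : Fin n, i ≠ j →
    P⟦{ω | A s(i, j) ω = true} | latentSigma ξ⟧ =ᵐ[P] fun ω => f (ξ i ω) (ξ j ω)
  /-- `P(B_s = 1 | B_{s-1}, B_{s-2}, …, ξ) = P(B_s = 1 | B_{s-1}, …, B_{s-l}, ξ)`. -/
  markov : ∀ s : Fin (n.choose 2),
    P⟦{ω | orderedEdge A ord s ω = true} |
        historySigma ξ (orderedEdge A ord) {t | t < s}⟧ =ᵐ[P]
      P⟦{ω | orderedEdge A ord s ω = true} |
        historySigma ξ (orderedEdge A ord) {t | t < s ∧ (s : ℕ) ≤ t + l}⟧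
  bound_pos : 0 < α'
  /-- `P(U_s = u | U_{s-l}, ξ) ≥ α'` for all `s` and `u`. -/
  transition_ge : ∀ (s : Fin (n.choose 2)) (u : Fin (n.choose 2) → Bool), ∀ᵐ ω ∂P,
    α' ≤ (P⟦{ω' | ∀ t : Fin (n.choose 2), t ≤ s → (s : ℕ) < t + l →
              orderedEdge A ord t ω' = u t} |
        historySigma ξ (orderedEdge A ord)
          {t | (t : ℕ) + l ≤ s ∧ (s : ℕ) < t + 2 * l}⟧) ω

/-- The dependence parameter `χ = (1 - 2α')^{1/l}`; it is `0` for conditionally independent edge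
variables, `l = 0`. -/
def dependenceParameter (l : ℕ) (α' : ℝ) : ℝ :=
  if l = 0 then 0 else (1 - 2 * α') ^ (1 / (l : ℝ))

/-- The least-squares criterion `L(Q, z)` of an observed graph `a`. -/
def blockLoss {n k : ℕ} (a : Sym2 (Fin n) → Bool) (Q : Matrix (Fin k) (Fin k) ℝ)
    (z : Fin n → Fin k) : ℝ :=
  ∑ b : Fin k, ∑ c : Fin k,
    ∑ p : Fin n × Fin n with z p.1 = b ∧ z p.2 = c ∧ p.1 < p.2,
      ((if a s(p.1, p.2) = true then 1 else 0) - Q b c) ^ 2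

/-- `θ` is a least-squares estimate with `k` blocks from the observed graph `a`:
`θ_{ij} = Q_{z(i) z(j)}` for `i ≠ j` and `θ_{ii} = 0`, where `(Q, z)` minimizes the criterion over
all symmetric real `k × k` matrices and all assignments of the nodes to `k` blocks. -/
def IsLeastSquaresEstimate {n : ℕ} (k : ℕ) (a : Sym2 (Fin n) → Bool)
    (θ : Matrix (Fin n) (Fin n) ℝ) : Prop :=
  ∃ (Q : Matrix (Fin k) (Fin k) ℝ) (z : Fin n → Fin k), Q.IsSymm ∧
    (∀ (Q' : Matrix (Fin k) (Fin k) ℝ) (z' : Fin n → Fin k), Q'.IsSymm →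
      blockLoss a Q z ≤ blockLoss a Q' z') ∧
    ∀ i j, θ i j = if i = j then 0 else Q (z i) (z j)

/-- The matrix of connection probabilities, `θ_{ij} = f(x_i, x_j)` for `i ≠ j` and
`θ_{ii} = 0`. -/
def connectionMatrix {n : ℕ} (f : I → I → ℝ) (x : Fin n → I) : Matrix (Fin n) (Fin n) ℝ :=
  fun i j => if i = j then 0 else f (x i) (x j)

/-- The normalized squared error `n⁻² ∑_{i,j} (θ̂_{ij} - θ_{ij})²`. -/
def normalizedError {n : ℕ} (θhat θ : Matrix (Fin n) (Fin n) ℝ) : ℝ :=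
  1 / (n : ℝ) ^ 2 * ∑ i, ∑ j, (θhat i j - θ i j) ^ 2

/-- The rate `n^{-2(α∧1)/(1+α∧1)} (1-χ)^{-2} log n`. -/
def graphonRate (α χ : ℝ) (n : ℕ) : ℝ :=
  (n : ℝ) ^ (-2 * min α 1 / (1 + min α 1)) * ((1 - χ) ^ 2)⁻¹ * Real.log n

end

/-! Fix the latent variables. Given them, the ordered edges form a finite binary sequence of memory
`l` with mean `θ`, so the probabilistic core is concentration for such sequences. The bound `α'` is
a Doeblin condition: for `l ≥ 1`, each block of `l` steps shrinks the oscillation of a conditional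
mean by `1 - 2α'` (`stepsOp_sub_le`), so the values up to time `s` move the conditional mean of the
value at `t` by at most `(1 - 2α') ^ ((t - s) / l)`. The Azuma–Hoeffding argument along the edge
order, with Schur's test for the increments, then makes every linear form of `A - θ` sub-Gaussian
with variance factor `K ^ 2` (`sum_mul_exp_le`). The geometric series gives `K = l / (2α')`, and `χ
^ l = 1 - 2α'` turns this into `K ≤ (L + 1) / (1 - χ)`. The order of the edges disappears, since `∑
w ^ 2` is invariant under permutations.

The rest is least squares. For the optimal labelling `z` the estimate is the orthogonal projection
of `A` onto functions constant on blocks, so its error splits into the projected noise and the bias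
of projecting `θ`. The basic inequality `bias_le_of_sum_sq_le` bounds this bias by that of a
competitor, the values of `f` on a grid of mesh `1/k`, plus noise terms. Given `ξ` and a labelling,
these are two linear forms and one quadratic form of rank at most `k ^ 2`. The quadratic form is
reduced to linear ones by integration against a Gaussian vector (`sum_mul_exp_sum_sq_le`). A union
bound over the `k ^ n` labellings suffices, with no net over matrices `Q`, because the directions
involved depend only on `ξ` and the labelling.

This yields, up to constants, `k ^ (-2α) + K ^ 2 (k ^ 2 + n log k) / n ^ 2`. The choice of `k`
balances `k ^ (-2α)` and `k ^ 2 / n ^ 2`, and `α ≤ 1` makes `log n / n` no larger than the rate. The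
expectation follows because the error is always at most `1` and the bad event has probability at
most `exp (-n)`. -/

/-! ### Averaging over the classes of a finite labelling -/

section BlockAverage

variable {E S : Type*} [Fintype E] [DecidableEq S]

/-- The average of `x` over the elements which have the same label as `e`. -/
noncomputable def blockAverage (c : E → S) (x : E → ℝ) (e : E) : ℝ :=
  (∑ e' with c e' = c e, x e') / (Finset.univ.filter fun e' => c e' = c e).card

lemma card_label_pos (c : E → S) (e : E) :
    (0 : ℝ) < ((Finset.univ.filter fun e' => c e' = c e).card : ℝ) := by
  exact_mod_cast Finset.card_pos.2 ⟨e, by simp⟩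

lemma blockAverage_add (c : E → S) (x y : E → ℝ) (e : E) :
    blockAverage c (fun e => x e + y e) e = blockAverage c x e + blockAverage c y e := by
  simp [blockAverage, Finset.sum_add_distrib, add_div]

lemma blockAverage_mem_Icc (c : E → S) {x : E → ℝ} (hx : ∀ e, x e ∈ Set.Icc (0 : ℝ) 1) (e : E) :
    blockAverage c x e ∈ Set.Icc (0 : ℝ) 1 := by
  have h := card_label_pos c e
  refine ⟨div_nonneg (Finset.sum_nonneg fun e _ => (hx e).1) h.le, ?_⟩
  rw [blockAverage, div_le_one h]
  calc _ ≤ ∑ e' with c e' = c e, (1 : ℝ) := Finset.sum_le_sum fun e _ => (hx e).2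
    _ = _ := by simp

lemma exists_blockAverage_eq (c : E → S) (x : E → ℝ) :
    ∃ g : S → ℝ, ∀ e, blockAverage c x e = g (c e) :=
  ⟨fun s => (∑ e' with c e' = s, x e') / (Finset.univ.filter fun e' => c e' = s).card,
    fun _ => rfl⟩

lemma measurable_blockAverage (c : E → S) (e : E) :
    Measurable fun x : E → ℝ => blockAverage c x e := by
  unfold blockAverage
  exact (Finset.measurable_sum _ fun e _ => measurable_pi_apply e).div_const _

variable [Fintype S]

/-- The residual of the block average is orthogonal to the functions of the label. -/
lemma sum_sub_blockAverage_mul (c : E → S) (x : E → ℝ) (g : S → ℝ) :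
    ∑ e, (x e - blockAverage c x e) * g (c e) = 0 := by
  rw [← Finset.sum_fiberwise (s := Finset.univ) (g := c)]
  refine Finset.sum_eq_zero fun s _ => ?_
  set T := Finset.univ.filter fun e => c e = s with hT
  have h1 : ∀ e ∈ T, (x e - blockAverage c x e) * g (c e)
      = (x e - (∑ e' ∈ T, x e') / T.card) * g s := by
    intro e he
    have he' : c e = s := by simpa [hT] using he
    simp only [blockAverage, he']
    rfl
  rw [Finset.sum_congr rfl h1, ← Finset.sum_mul, Finset.sum_sub_distrib, Finset.sum_const,
    nsmul_eq_mul]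
  rcases T.eq_empty_or_nonempty with h | h
  · simp [h]
  · have : (T.card : ℝ) ≠ 0 := by exact_mod_cast h.card_pos.ne'
    field_simp
    simp

/-- Pythagoras: block averaging is the orthogonal projection onto the functions of the label. It
identifies the minimizer over `Q` for a fixed labelling. -/
lemma sum_sq_sub_eq_blockAverage (c : E → S) (x : E → ℝ) (g : S → ℝ) :
    ∑ e, (x e - g (c e)) ^ 2
      = ∑ e, (x e - blockAverage c x e) ^ 2 + ∑ e, (blockAverage c x e - g (c e)) ^ 2 := by
  obtain ⟨h, hh⟩ := exists_blockAverage_eq c x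
  have := sum_sub_blockAverage_mul c x fun s => h s - g s
  have h2 : ∑ e, (x e - g (c e)) ^ 2 = ∑ e, (x e - blockAverage c x e) ^ 2
      + ∑ e, (blockAverage c x e - g (c e)) ^ 2
      + 2 * ∑ e, (x e - blockAverage c x e) * (h (c e) - g (c e)) := by
    rw [Finset.mul_sum, ← Finset.sum_add_distrib, ← Finset.sum_add_distrib]
    refine Finset.sum_congr rfl fun e _ => ?_
    rw [hh]; ring
  rw [h2, this]; ring

/-- The error of the block average of `a = θ + ε` splits into bias and variance. -/
lemma sum_sq_blockAverage_sub (c : E → S) (a θ : E → ℝ) :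
    ∑ e, (blockAverage c a e - θ e) ^ 2
      = ∑ e, (blockAverage c (fun e => a e - θ e) e) ^ 2
        + ∑ e, (θ e - blockAverage c θ e) ^ 2 := by
  obtain ⟨h, hh⟩ := exists_blockAverage_eq c (fun e => a e - θ e)
  have hadd : ∀ e, blockAverage c a e = blockAverage c (fun e => a e - θ e) e
      + blockAverage c θ e := fun e => by
    rw [← blockAverage_add]; congr 1; ext; ring
  have := sum_sub_blockAverage_mul c θ h
  have h2 : ∑ e, (blockAverage c a e - θ e) ^ 2
      = ∑ e, (blockAverage c (fun e => a e - θ e) e) ^ 2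
        + ∑ e, (θ e - blockAverage c θ e) ^ 2
        - 2 * ∑ e, (θ e - blockAverage c θ e) * h (c e) := by
    rw [Finset.mul_sum, ← Finset.sum_add_distrib, ← Finset.sum_sub_distrib]
    refine Finset.sum_congr rfl fun e _ => ?_
    rw [hadd, hh]; ring
  rw [h2, this]; ring

/-- The basic inequality of least squares: the bias is controlled by that of a competitor and by
the noise `a - θ`. -/
lemma bias_le_of_sum_sq_le (c : E → S) (a θ η : E → ℝ)
    (h : ∑ e, (a e - blockAverage c a e) ^ 2 ≤ ∑ e, (a e - η e) ^ 2) :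
    ∑ e, (θ e - blockAverage c θ e) ^ 2 ≤ ∑ e, (θ e - η e) ^ 2
      + 2 * ∑ e, (θ e - η e) * (a e - θ e)
      - 2 * ∑ e, (θ e - blockAverage c θ e) * (a e - θ e)
      + ∑ e, (blockAverage c (fun e => a e - θ e) e) ^ 2 := by
  obtain ⟨g, hg⟩ := exists_blockAverage_eq c (fun e => a e - θ e)
  have hadd : ∀ e, blockAverage c a e = blockAverage c (fun e => a e - θ e) e
      + blockAverage c θ e := fun e => by
    rw [← blockAverage_add]; congr 1; ext; ring
  have h1 := sum_sub_blockAverage_mul c θ g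
  have h2 := sum_sub_blockAverage_mul c (fun e => a e - θ e) g
  have e1 : ∑ e, (a e - blockAverage c a e) ^ 2
      = ∑ e, (θ e - blockAverage c θ e) ^ 2 + 2 * ∑ e, (θ e - blockAverage c θ e) * (a e - θ e)
        + ∑ e, (a e - θ e) ^ 2 - ∑ e, (blockAverage c (fun e => a e - θ e) e) ^ 2
        - 2 * ∑ e, (θ e - blockAverage c θ e) * g (c e)
        - 2 * ∑ e, (a e - θ e - blockAverage c (fun e => a e - θ e) e) * g (c e) := by
    simp only [Finset.mul_sum, ← Finset.sum_add_distrib, ← Finset.sum_sub_distrib]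
    refine Finset.sum_congr rfl fun e _ => ?_
    rw [hadd, hg]; ring
  have e2 : ∑ e, (a e - η e) ^ 2 = ∑ e, (θ e - η e) ^ 2
      + 2 * ∑ e, (θ e - η e) * (a e - θ e) + ∑ e, (a e - θ e) ^ 2 := by
    simp only [Finset.mul_sum, ← Finset.sum_add_distrib]
    refine Finset.sum_congr rfl fun e _ => ?_
    ring
  rw [e1, e2, h1, h2] at h
  linarith

/-- The normalized indicator functions of the blocks. -/
noncomputable def blockIndicator (c : E → S) (s : S) (e : E) : ℝ :=
  if c e = s then (√((Finset.univ.filter fun e' => c e' = s).card : ℝ))⁻¹ else 0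

/-- The indicators of the nonempty blocks are orthonormal and span the range of the projection; this
is Parseval. It writes the projected noise as a sum of squares of linear forms. -/
lemma sum_sq_blockAverage (c : E → S) (x : E → ℝ) :
    ∑ e, (blockAverage c x e) ^ 2 = ∑ s, (∑ e, blockIndicator c s e * x e) ^ 2 := by
  rw [← Finset.sum_fiberwise (s := Finset.univ) (g := c)]
  refine Finset.sum_congr rfl fun s _ => ?_
  set T := Finset.univ.filter fun e => c e = s with hT
  have h1 : ∀ e ∈ T, (blockAverage c x e) ^ 2 = ((∑ e' ∈ T, x e') / T.card) ^ 2 := by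
    intro e he
    have he' : c e = s := by simpa [hT] using he
    simp only [blockAverage, he']
    rfl
  have h2 : ∑ e, blockIndicator c s e * x e = (√(T.card : ℝ))⁻¹ * ∑ e ∈ T, x e := by
    rw [hT, Finset.sum_filter, Finset.mul_sum]
    refine Finset.sum_congr rfl fun e _ => ?_
    unfold blockIndicator
    split_ifs <;> simp
  rw [Finset.sum_congr rfl h1, Finset.sum_const, h2, nsmul_eq_mul, mul_pow, inv_pow,
    Real.sq_sqrt (by positivity)]
  rcases T.eq_empty_or_nonempty with h | h
  · simp [h]
  · have : (T.card : ℝ) ≠ 0 := by exact_mod_cast h.card_pos.ne'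
    field_simp

/-- Bessel's inequality in dual form. Equality fails only through empty blocks, whose indicator is
zero. -/
lemma sum_sq_sum_blockIndicator_le (c : E → S) (g : S → ℝ) :
    ∑ e, (∑ s, g s * blockIndicator c s e) ^ 2 ≤ ∑ s, g s ^ 2 := by
  have h1 : ∀ e, ∑ s, g s * blockIndicator c s e = g (c e) * blockIndicator c (c e) e := by
    intro e
    rw [Finset.sum_eq_single (c e)]
    · intro s _ hs
      simp [blockIndicator, hs.symm]
    · simp
  simp_rw [h1]
  rw [← Finset.sum_fiberwise (s := Finset.univ) (g := c)]
  refine Finset.sum_le_sum fun s _ => ?_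
  set T := Finset.univ.filter fun e => c e = s with hT
  have h2 : ∀ e ∈ T, (g (c e) * blockIndicator c (c e) e) ^ 2 = g s ^ 2 * (T.card : ℝ)⁻¹ := by
    intro e he
    have he' : c e = s := by simpa [hT] using he
    simp only [blockIndicator, he', if_true]
    rw [mul_pow, inv_pow, Real.sq_sqrt (by positivity)]
  rw [Finset.sum_congr rfl h2, Finset.sum_const, nsmul_eq_mul]
  rcases T.eq_empty_or_nonempty with h | h
  · simp [h, sq_nonneg]
  · have : (T.card : ℝ) ≠ 0 := by exact_mod_cast h.card_pos.ne'
    field_simp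
    rfl

end BlockAverage

/-! ### The least-squares estimate -/

/-- The label of a pair of nodes: the unordered pair of the labels of the nodes. -/
def pairLabel {n k : ℕ} (z : Fin n → Fin k) (e : NodePair n) : Sym2 (Fin k) :=
  Sym2.map z e.1

/-- The observed edge indicators as real numbers. -/
def edgeValue {n : ℕ} (a : Sym2 (Fin n) → Bool) (e : NodePair n) : ℝ :=
  if a e.1 = true then 1 else 0

lemma sum_nodePair {n : ℕ} (h : Sym2 (Fin n) → ℝ) :
    ∑ e : NodePair n, h e.1
      = ∑ p : Fin n × Fin n with p.1 < p.2, h s(p.1, p.2) := by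
  have := Finset.sum_sym2_filter_not_isDiag (Finset.univ : Finset (Fin n)) h
  have h2 : (Finset.univ : Finset (Fin n)).sym2 = Finset.univ := by
    ext; simp
  rw [h2] at this
  rw [← Finset.sum_subtype (Finset.univ.filter fun e : Sym2 (Fin n) => ¬ e.IsDiag) (by simp) h,
    this]
  refine Finset.sum_congr ?_ fun _ _ => rfl
  ext p
  simp only [Finset.mem_filter, Finset.mem_offDiag, Finset.mem_univ, true_and]
  exact ⟨fun h => h.2, fun h => ⟨h.ne, h⟩⟩

lemma blockLoss_eq_sum_nodePair {n k : ℕ} (a : Sym2 (Fin n) → Bool)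
    (g : Sym2 (Fin k) → ℝ) (z : Fin n → Fin k) :
    blockLoss a (fun b c => g s(b, c)) z = ∑ e, (edgeValue a e - g (pairLabel z e)) ^ 2 := by
  have h1 := sum_nodePair (n := n) fun e =>
    ((if a e = true then (1 : ℝ) else 0) - g (Sym2.map z e)) ^ 2
  unfold edgeValue pairLabel
  unfold blockLoss
  rw [h1, ← Finset.sum_fiberwise (s := Finset.univ.filter _) (g := fun p => z p.1)]
  refine Finset.sum_congr rfl fun b _ => ?_
  rw [← Finset.sum_fiberwise (s := Finset.filter _ _) (g := fun p : Fin n × Fin n => z p.2)]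
  refine Finset.sum_congr rfl fun c _ => ?_
  refine Finset.sum_congr ?_ ?_
  · ext p; simp; tauto
  · intro p hp
    simp only [Finset.mem_filter] at hp
    simp [hp.1.2, hp.2]

/-- For the optimal labelling, Pythagoras forces `Q` to equal the block averages on every block that
contains a pair. Entries of `Q` for empty blocks stay undetermined but never enter the estimate. -/
lemma exists_blockAverage_of_isLeastSquaresEstimate {n k : ℕ} {a : Sym2 (Fin n) → Bool}
    {θ : Matrix (Fin n) (Fin n) ℝ} (h : IsLeastSquaresEstimate k a θ) :
    ∃ z : Fin n → Fin k,
      (∀ i, θ i i = 0) ∧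
      (∀ (i j : Fin n) (hij : ¬ (s(i, j) : Sym2 (Fin n)).IsDiag),
        θ i j = blockAverage (pairLabel z) (edgeValue a) ⟨s(i, j), hij⟩) ∧
      ∀ (z' : Fin n → Fin k) (g : Sym2 (Fin k) → ℝ),
        ∑ e, (edgeValue a e - blockAverage (pairLabel z) (edgeValue a) e) ^ 2
          ≤ ∑ e, (edgeValue a e - g (pairLabel z' e)) ^ 2 := by
  obtain ⟨Q, z, hQ, hmin, hθ⟩ := h
  -- A symmetric matrix is a function on unordered pairs of labels, so it is a function of
  -- `pairLabel`.
  obtain ⟨q, rfl⟩ : ∃ q : Sym2 (Fin k) → ℝ, Q = fun b c => q s(b, c) :=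
    ⟨Sym2.lift ⟨fun b c => Q b c, fun b c => hQ.apply c b⟩, by ext b c; simp⟩
  have hmin' : ∀ (z' : Fin n → Fin k) (g : Sym2 (Fin k) → ℝ),
      ∑ e, (edgeValue a e - q (pairLabel z e)) ^ 2
        ≤ ∑ e, (edgeValue a e - g (pairLabel z' e)) ^ 2 := by
    intro z' g
    have := hmin (fun b c => g s(b, c)) z' (by ext b c; simp [Matrix.transpose, Sym2.eq_swap])
    rwa [blockLoss_eq_sum_nodePair, blockLoss_eq_sum_nodePair] at this
  have hpy := sum_sq_sub_eq_blockAverage (pairLabel z) (edgeValue a) q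
  obtain ⟨g, hg⟩ := exists_blockAverage_eq (pairLabel z) (edgeValue a)
  -- The block averages themselves serve as competitor: they cannot do better than `q`, so the
  -- Pythagorean excess of `q` vanishes.
  have hle := hmin' z g
  simp_rw [← hg] at hle
  have h0 : ∑ e, (blockAverage (pairLabel z) (edgeValue a) e - q (pairLabel z e)) ^ 2 = 0 :=
    le_antisymm (by linarith) (Finset.sum_nonneg fun _ _ => sq_nonneg _)
  rw [Finset.sum_eq_zero_iff_of_nonneg fun _ _ => sq_nonneg _] at h0
  have heq : ∀ e, blockAverage (pairLabel z) (edgeValue a) e = q (pairLabel z e) := fun e =>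
    sub_eq_zero.1 (pow_eq_zero_iff two_ne_zero |>.1 (h0 e (Finset.mem_univ _)))
  refine ⟨z, fun i => by simp [hθ], fun i j hij => ?_, fun z' g => ?_⟩
  · have : i ≠ j := by simpa using hij
    rw [heq, hθ, if_neg this]; rfl
  · simp_rw [heq]; exact hmin' z' g

lemma normalizedError_eq_sum_nodePair {n : ℕ} {θ η : Matrix (Fin n) (Fin n) ℝ}
    {x y : Sym2 (Fin n) → ℝ} (hθ : ∀ i j, i ≠ j → θ i j = x s(i, j))
    (hη : ∀ i j, i ≠ j → η i j = y s(i, j)) (hd : ∀ i, θ i i = η i i) :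
    normalizedError θ η = 2 / (n : ℝ) ^ 2 * ∑ e : NodePair n, (x e.1 - y e.1) ^ 2 := by
  have h1 : ∑ i, ∑ j, (θ i j - η i j) ^ 2
      = 2 * ∑ p : Fin n × Fin n with p.1 < p.2, (x s(p.1, p.2) - y s(p.1, p.2)) ^ 2 := by
    rw [← Finset.univ_product_univ, ← Finset.sum_product']
    rw [two_mul]
    have hsw : ∑ p ∈ (Finset.univ ×ˢ Finset.univ : Finset (Fin n × Fin n)) with p.1 < p.2,
        (x s(p.1, p.2) - y s(p.1, p.2)) ^ 2
        = ∑ p ∈ (Finset.univ ×ˢ Finset.univ : Finset (Fin n × Fin n)) with p.2 < p.1,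
          (x s(p.1, p.2) - y s(p.1, p.2)) ^ 2 := by
      refine Finset.sum_nbij' Prod.swap Prod.swap ?_ ?_ ?_ ?_ ?_ <;>
        simp [Sym2.eq_swap]
    nth_rewrite 2 [hsw]
    rw [Finset.sum_filter, Finset.sum_filter, ← Finset.sum_add_distrib]
    refine Finset.sum_congr rfl fun p _ => ?_
    obtain ⟨i, j⟩ := p
    rcases lt_trichotomy i j with h | h | h
    · simp [h, h.not_gt, hθ i j h.ne, hη i j h.ne]
    · subst h; simp [hd]
    · simp [h, h.not_gt, hθ i j h.ne', hη i j h.ne']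
  rw [normalizedError, h1, sum_nodePair fun e => (x e - y e) ^ 2]
  ring

/-! ### Markov chains of bounded memory on a finite time interval -/

section Chain

variable {N : ℕ}

/-- The one-step operator at time `s`: replace the value at `s` by its conditional distribution,
which gives `true` the probability `q s b`. It is the identity for `s ≥ N`. -/
noncomputable def stepOp (q : Fin N → (Fin N → Bool) → ℝ) (s : ℕ)
    (F : (Fin N → Bool) → ℝ) (b : Fin N → Bool) : ℝ :=
  if h : s < N then
    q ⟨s, h⟩ b * F (Function.update b ⟨s, h⟩ true)
      + (1 - q ⟨s, h⟩ b) * F (Function.update b ⟨s, h⟩ false)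
  else F b

/-- The operator of the `m` steps at the times `j, …, j + m - 1`. -/
noncomputable def stepsOp (q : Fin N → (Fin N → Bool) → ℝ) (j : ℕ) :
    ℕ → ((Fin N → Bool) → ℝ) → (Fin N → Bool) → ℝ
  | 0, F => F
  | m + 1, F => stepOp q j (stepsOp q (j + 1) m F)

variable {q : Fin N → (Fin N → Bool) → ℝ}

lemma stepOp_add (s : ℕ) (F G : (Fin N → Bool) → ℝ) :
    stepOp q s (fun b => F b + G b) = fun b => stepOp q s F b + stepOp q s G b := by
  ext b; unfold stepOp; split_ifs <;> ring

lemma stepOp_const_mul (s : ℕ) (r : ℝ) (F : (Fin N → Bool) → ℝ) :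
    stepOp q s (fun b => r * F b) = fun b => r * stepOp q s F b := by
  ext b; unfold stepOp; split_ifs <;> ring

lemma stepOp_mono (hq : ∀ s b, q s b ∈ Set.Icc (0 : ℝ) 1) (s : ℕ) {F G : (Fin N → Bool) → ℝ}
    (h : ∀ b, F b ≤ G b) (b : Fin N → Bool) : stepOp q s F b ≤ stepOp q s G b := by
  unfold stepOp
  split_ifs with hs
  · have h0 := (hq ⟨s, hs⟩ b).1
    have h1 := (hq ⟨s, hs⟩ b).2
    exact add_le_add (mul_le_mul_of_nonneg_left (h _) h0)
      (mul_le_mul_of_nonneg_left (h _) (by linarith))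
  · exact h b

/-- Factors which do not involve the value at `s` can be pulled out of the step at `s`. -/
lemma stepOp_mul_left {s : ℕ} {S : Set (Fin N)} (hS : ∀ t ∈ S, (t : ℕ) ≠ s)
    {F : (Fin N → Bool) → ℝ} (hF : DependsOn F S) (G : (Fin N → Bool) → ℝ) :
    stepOp q s (fun b => F b * G b) = fun b => F b * stepOp q s G b := by
  ext b
  unfold stepOp
  split_ifs with h
  · have hu : ∀ v, F (Function.update b ⟨s, h⟩ v) = F b := fun v => hF fun t ht => by
      rw [Function.update_of_ne]
      intro hts
      exact hS t ht (by simp [hts])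
    simp only [hu]; ring
  · rfl

lemma stepOp_const (s : ℕ) (r : ℝ) : stepOp q s (fun _ => r) = fun _ => r := by
  ext b; unfold stepOp; split_ifs <;> ring

lemma stepOp_of_dependsOn {s : ℕ} {S : Set (Fin N)} (hS : ∀ t ∈ S, (t : ℕ) ≠ s)
    {F : (Fin N → Bool) → ℝ} (hF : DependsOn F S) : stepOp q s F = F := by
  have := stepOp_mul_left (q := q) hS hF fun _ => 1
  simpa [stepOp_const] using this

/-- The step at `s` replaces the dependence on the value at `s` by that on the `l` values before. -/
lemma DependsOn.stepOp {l : ℕ} (hql : ∀ s, DependsOn (q s) {t | t < s ∧ (s : ℕ) ≤ t + l})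
    {s : ℕ} {F : (Fin N → Bool) → ℝ} {S S' : Set (Fin N)} (hF : DependsOn F S)
    (h1 : ∀ t ∈ S, (t : ℕ) ≠ s → t ∈ S') (h2 : ∀ t : Fin N, (t : ℕ) < s → s ≤ t + l → t ∈ S')
    (hs : s < N) :
    DependsOn (stepOp q s F) S' := by
  intro b b' hb
  unfold _root_.stepOp
  simp only [hs, dif_pos]
  have e1 : q ⟨s, hs⟩ b = q ⟨s, hs⟩ b' := hql _ fun t ht => hb t (h2 t ht.1 ht.2)
  have e2 : ∀ v, F (Function.update b ⟨s, hs⟩ v) = F (Function.update b' ⟨s, hs⟩ v) := by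
    intro v
    refine hF fun t ht => ?_
    by_cases hts : t = ⟨s, hs⟩
    · subst hts; simp
    · rw [Function.update_of_ne hts, Function.update_of_ne hts]
      exact hb t (h1 t ht fun h => hts (Fin.ext h))
  rw [e1, e2, e2]

lemma stepsOp_add (j m : ℕ) (F G : (Fin N → Bool) → ℝ) :
    stepsOp q j m (fun b => F b + G b) = fun b => stepsOp q j m F b + stepsOp q j m G b := by
  induction m generalizing j with
  | zero => rfl
  | succ m ih => simp only [stepsOp, ih, stepOp_add]

lemma stepsOp_const_mul (j m : ℕ) (r : ℝ) (F : (Fin N → Bool) → ℝ) :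
    stepsOp q j m (fun b => r * F b) = fun b => r * stepsOp q j m F b := by
  induction m generalizing j with
  | zero => rfl
  | succ m ih => simp only [stepsOp, ih, stepOp_const_mul]

lemma stepsOp_const (j m : ℕ) (r : ℝ) : stepsOp q j m (fun _ => r) = fun _ => r := by
  induction m generalizing j with
  | zero => rfl
  | succ m ih => simp only [stepsOp, ih, stepOp_const]

lemma stepsOp_sum {ι : Type*} (T : Finset ι) (j m : ℕ) (F : ι → (Fin N → Bool) → ℝ) :
    stepsOp q j m (fun b => ∑ i ∈ T, F i b) = fun b => ∑ i ∈ T, stepsOp q j m (F i) b := by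
  classical
  induction T using Finset.induction_on with
  | empty => simp [stepsOp_const]
  | insert i T hi ih => simp only [Finset.sum_insert hi, stepsOp_add, ih]

lemma stepsOp_mono (hq : ∀ s b, q s b ∈ Set.Icc (0 : ℝ) 1) (j m : ℕ)
    {F G : (Fin N → Bool) → ℝ} (h : ∀ b, F b ≤ G b) (b : Fin N → Bool) :
    stepsOp q j m F b ≤ stepsOp q j m G b := by
  induction m generalizing j b with
  | zero => exact h b
  | succ m ih => exact stepOp_mono hq j (fun b => ih (j + 1) b) b

lemma stepsOp_mem_Icc (hq : ∀ s b, q s b ∈ Set.Icc (0 : ℝ) 1) (j m : ℕ)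
    {F : (Fin N → Bool) → ℝ} {u v : ℝ} (h : ∀ b, F b ∈ Set.Icc u v) (b : Fin N → Bool) :
    stepsOp q j m F b ∈ Set.Icc u v := by
  have h1 := stepsOp_mono hq j m (fun b => (h b).1) b
  have h2 := stepsOp_mono hq j m (fun b => (h b).2) b
  rw [stepsOp_const] at h1 h2
  exact ⟨h1, h2⟩

lemma stepsOp_stepsOp (j m m' : ℕ) (F : (Fin N → Bool) → ℝ) :
    stepsOp q j m (stepsOp q (j + m) m' F) = stepsOp q j (m + m') F := by
  induction m generalizing j with
  | zero => simp [stepsOp]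
  | succ m ih =>
    rw [Nat.succ_add]
    simp only [stepsOp]
    rw [← ih (j + 1)]
    congr 3
    omega

lemma stepsOp_of_dependsOn {j m : ℕ} {S : Set (Fin N)} (hS : ∀ t ∈ S, (t : ℕ) < j)
    {F : (Fin N → Bool) → ℝ} (hF : DependsOn F S) : stepsOp q j m F = F := by
  induction m generalizing j with
  | zero => rfl
  | succ m ih =>
    simp only [stepsOp]
    rw [ih fun t ht => (hS t ht).trans (Nat.lt_succ_self j)]
    exact stepOp_of_dependsOn (fun t ht => (hS t ht).ne) hF

/-- After `m` steps a function of the last `l` values up to `j + m` becomes a function of the last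
`l` values up to `j`. -/
lemma dependsOn_stepsOp {l : ℕ} (hql : ∀ s, DependsOn (q s) {t | t < s ∧ (s : ℕ) ≤ t + l})
    {j m : ℕ} (hjm : j + m ≤ N) {F : (Fin N → Bool) → ℝ}
    (hF : DependsOn F {t | (t : ℕ) < j + m ∧ j + m ≤ t + l}) :
    DependsOn (stepsOp q j m F) {t | (t : ℕ) < j ∧ j ≤ t + l} := by
  induction m generalizing j with
  | zero => simpa [stepsOp] using hF
  | succ m ih =>
    simp only [stepsOp]
    have h := ih (j := j + 1) (by omega) (by convert hF using 4 <;> omega)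
    refine h.stepOp hql ?_ ?_ (by omega)
    · rintro t ⟨h1, h2⟩ h3
      exact ⟨by omega, by omega⟩
    · intro t h1 h2
      exact ⟨h1, h2⟩

end Chain

/-! ### The law of a path of finite memory and its backward conditional expectations -/

section Chain

variable {N : ℕ}

/-- The probability of a set of paths. -/
noncomputable def pathProb (p : (Fin N → Bool) → ℝ) (X : Set (Fin N → Bool)) : ℝ :=
  ∑ b, X.indicator p b

/-- The paths which agree with `b` at the times in `S`. -/
def agreeOn (S : Set (Fin N)) (b : Fin N → Bool) : Set (Fin N → Bool) :=
  {x | ∀ t ∈ S, x t = b t}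

/-- The probability mass functions of binary sequences with memory `l`. -/
structure IsMemoryChain (p : (Fin N → Bool) → ℝ) (l : ℕ) : Prop where
  nonneg : ∀ b, 0 ≤ p b
  sum_eq_one : ∑ b, p b = 1
  markov : ∀ (s : Fin N) (b : Fin N → Bool),
    pathProb p (agreeOn {t | t < s} b) *
        pathProb p (agreeOn {t | t < s ∧ (s : ℕ) ≤ t + l} b ∩ {x | x s = true})
      = pathProb p (agreeOn {t | t < s} b ∩ {x | x s = true}) *
        pathProb p (agreeOn {t | t < s ∧ (s : ℕ) ≤ t + l} b)

/-- The conditional probability of the value `true` at `s` given the `l` values before. -/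
noncomputable def transProb (p : (Fin N → Bool) → ℝ) (l : ℕ) (s : Fin N) (b : Fin N → Bool) : ℝ :=
  pathProb p (agreeOn {t | t < s ∧ (s : ℕ) ≤ t + l} b ∩ {x | x s = true})
    / pathProb p (agreeOn {t | t < s ∧ (s : ℕ) ≤ t + l} b)

variable {p : (Fin N → Bool) → ℝ} {l : ℕ}

lemma agreeOn_congr {S : Set (Fin N)} {b b' : Fin N → Bool} (h : ∀ t ∈ S, b t = b' t) :
    agreeOn S b = agreeOn S b' := by
  ext x
  exact forall₂_congr fun t ht => by rw [h t ht]

lemma self_mem_agreeOn (S : Set (Fin N)) (b : Fin N → Bool) : b ∈ agreeOn S b :=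
  fun _ _ => rfl

lemma pathProb_nonneg (hp : ∀ b, 0 ≤ p b) (X : Set (Fin N → Bool)) : 0 ≤ pathProb p X :=
  Finset.sum_nonneg fun b _ => Set.indicator_nonneg (fun b _ => hp b) b

lemma pathProb_mono (hp : ∀ b, 0 ≤ p b) {X Y : Set (Fin N → Bool)} (h : X ⊆ Y) :
    pathProb p X ≤ pathProb p Y :=
  Finset.sum_le_sum fun b _ => Set.indicator_le_indicator_of_subset h (fun b => hp b) b

lemma le_pathProb (hp : ∀ b, 0 ≤ p b) {X : Set (Fin N → Bool)} {b : Fin N → Bool} (hb : b ∈ X) :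
    p b ≤ pathProb p X := by
  have := Finset.single_le_sum (f := fun b => X.indicator p b)
    (fun b _ => Set.indicator_nonneg (fun b _ => hp b) b) (Finset.mem_univ b)
  simpa [Set.indicator_of_mem hb, pathProb] using this

lemma pathProb_eq_sum_mul (X : Set (Fin N → Bool)) :
    pathProb p X = ∑ b, p b * X.indicator (fun _ => 1) b := by
  refine Finset.sum_congr rfl fun b _ => ?_
  by_cases h : b ∈ X <;> simp [h]

namespace IsMemoryChain

lemma transProb_mem_Icc (h : IsMemoryChain p l) (s : Fin N) (b : Fin N → Bool) :
    transProb p l s b ∈ Set.Icc (0 : ℝ) 1 :=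
  ⟨div_nonneg (pathProb_nonneg h.nonneg _) (pathProb_nonneg h.nonneg _),
    div_le_one_of_le₀ (pathProb_mono h.nonneg Set.inter_subset_left) (pathProb_nonneg h.nonneg _)⟩

lemma dependsOn_transProb (p : (Fin N → Bool) → ℝ) (l : ℕ) (s : Fin N) :
    DependsOn (transProb p l s) {t | t < s ∧ (s : ℕ) ≤ t + l} := by
  intro b b' hb
  unfold transProb
  rw [agreeOn_congr hb]

lemma pathProb_past_inter (h : IsMemoryChain p l) (s : Fin N) (b : Fin N → Bool) :
    pathProb p (agreeOn {t | t < s} b ∩ {x | x s = true})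
      = transProb p l s b * pathProb p (agreeOn {t | t < s} b) := by
  have hm := h.markov s b
  unfold transProb
  -- If the window has probability zero then `transProb` is a division by zero, with value `0`; the
  -- left side is zero too, since the past event lies in the window event.
  by_cases h0 : pathProb p (agreeOn {t | t < s ∧ (s : ℕ) ≤ t + l} b) = 0
  · have h1 : pathProb p (agreeOn {t | t < s} b ∩ {x | x s = true})
        ≤ pathProb p (agreeOn {t | t < s ∧ (s : ℕ) ≤ t + l} b) :=
      pathProb_mono h.nonneg fun x hx t ht => hx.1 t ht.1
    rw [h0] at h1 ⊢
    simp [le_antisymm h1 (pathProb_nonneg h.nonneg _)]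
  · field_simp
    linarith

/-- The value at `s` minus its transition probability is orthogonal to the functions of the
past. -/
lemma sum_mul_sub_transProb (h : IsMemoryChain p l) (s : Fin N) {G : (Fin N → Bool) → ℝ}
    (hG : DependsOn G {t | t < s}) :
    ∑ b, p b * (((if b s = true then 1 else 0) - transProb p l s b) * G b) = 0 := by
  classical
  -- `r` resets the values from `s` on to `false`, choosing one representative per past. Its fibres
  -- over such representatives are the cylinders `agreeOn {t | t < s} c`; the other fibres are
  -- empty.
  let r : (Fin N → Bool) → (Fin N → Bool) := fun b t => if t < s then b t else false
  rw [← Finset.sum_fiberwise (s := Finset.univ) (g := r)]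
  refine Finset.sum_eq_zero fun c _ => ?_
  by_cases hc : r c = c
  swap
  · refine Finset.sum_eq_zero fun b hb => absurd ?_ hc
    have : r b = c := by simpa using hb
    rw [← this]
    ext t; simp only [r]; split_ifs <;> rfl
  have hfib : ∀ b, r b = c ↔ b ∈ agreeOn {t | t < s} c := by
    intro b
    constructor
    · rintro rfl t ht
      have ht' : t < s := ht
      simp [r, ht']
    · intro hb
      rw [← hc]
      ext t
      by_cases ht : t < s
      · simp [r, ht, hb t ht]
      · simp [r, ht]
  have hterm : ∀ b, (if r b = c then
        p b * (((if b s = true then 1 else 0) - transProb p l s b) * G b) else 0)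
      = ((agreeOn {t | t < s} c ∩ {x | x s = true}).indicator p b
        - transProb p l s c * (agreeOn {t | t < s} c).indicator p b) * G c := by
    intro b
    by_cases hb : r b = c
    · have hb' := (hfib b).1 hb
      have e1 : G b = G c := hG hb'
      have e2 : transProb p l s b = transProb p l s c :=
        dependsOn_transProb p l s fun t ht => hb' t ht.1
      rw [if_pos hb, e1, e2, Set.indicator_of_mem hb']
      by_cases hs : b s = true
      · rw [Set.indicator_of_mem (Set.mem_inter hb' hs), if_pos hs]; ring
      · rw [Set.indicator_of_notMem (fun hx => hs hx.2), if_neg hs]; ring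
    · have hb' := fun hx => hb ((hfib b).2 hx)
      rw [if_neg hb, Set.indicator_of_notMem hb', Set.indicator_of_notMem fun hx => hb' hx.1]
      ring
  rw [Finset.sum_filter, Finset.sum_congr rfl fun b _ => hterm b, ← Finset.sum_mul,
    Finset.sum_sub_distrib, ← Finset.mul_sum]
  have := h.pathProb_past_inter s c
  unfold pathProb at this
  rw [this]
  ring

/-- The tower property for one step. The restriction on `F` is needed because `stepOp` changes the
value at `s` while leaving later values fixed. -/
lemma sum_mul_stepOp (h : IsMemoryChain p l) (s : ℕ) {F : (Fin N → Bool) → ℝ}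
    (hF : DependsOn F {t | (t : ℕ) ≤ s}) :
    ∑ b, p b * stepOp (transProb p l) s F b = ∑ b, p b * F b := by
  by_cases hs : s < N
  swap
  · simp [stepOp, hs]
  -- The difference `F - stepOp F` equals the centred value at `s` times this increment, which is a
  -- function of the strict past; `sum_mul_sub_transProb` then applies.
  have hG : DependsOn (fun b => F (Function.update b ⟨s, hs⟩ true)
      - F (Function.update b ⟨s, hs⟩ false)) {t | t < ⟨s, hs⟩} := by
    intro b b' hb
    have : ∀ v, F (Function.update b ⟨s, hs⟩ v) = F (Function.update b' ⟨s, hs⟩ v) := by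
      intro v
      refine hF fun t ht => ?_
      by_cases hts : t = ⟨s, hs⟩
      · subst hts; simp
      · rw [Function.update_of_ne hts, Function.update_of_ne hts]
        exact hb t (lt_of_le_of_ne ht hts)
    simp only [this]
  have := h.sum_mul_sub_transProb ⟨s, hs⟩ hG
  rw [← sub_eq_zero, ← Finset.sum_sub_distrib, ← neg_eq_zero, ← Finset.sum_neg_distrib, ← this]
  refine Finset.sum_congr rfl fun b _ => ?_
  simp only [stepOp, hs, dif_pos]
  cases hb : b ⟨s, hs⟩
  · have : F b = F (Function.update b ⟨s, hs⟩ false) := by rw [← hb, Function.update_eq_self]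
    rw [this]; simp only [Bool.false_eq_true, if_false]; ring
  · have : F b = F (Function.update b ⟨s, hs⟩ true) := by rw [← hb, Function.update_eq_self]
    rw [this]; simp only [if_true]; ring

lemma dependsOn_stepsOp_lt {j m : ℕ} (hjm : j + m ≤ N) {F : (Fin N → Bool) → ℝ}
    (hF : DependsOn F {t | (t : ℕ) < j + m}) :
    DependsOn (stepsOp (transProb p l) j m F) {t | (t : ℕ) < j} := by
  -- Memory `N` covers the whole past, so `dependsOn_stepsOp` with `l` replaced by `N` gives plain
  -- adaptedness.
  have hql : ∀ s, DependsOn (transProb p l s) {t | t < s ∧ (s : ℕ) ≤ t + N} := fun s =>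
    fun b b' hb => dependsOn_transProb p l s fun t ht => hb t ⟨ht.1, by omega⟩
  have := dependsOn_stepsOp hql hjm (F := F) fun b b' hb => hF fun t ht =>
    hb t ⟨ht, by omega⟩
  exact fun b b' hb => this fun t ht => hb t ht.1

lemma sum_mul_stepsOp (h : IsMemoryChain p l) {j m : ℕ} (hjm : j + m ≤ N)
    {F : (Fin N → Bool) → ℝ} (hF : DependsOn F {t | (t : ℕ) < j + m}) :
    ∑ b, p b * stepsOp (transProb p l) j m F b = ∑ b, p b * F b := by
  induction m generalizing j with
  | zero => rfl
  | succ m ih =>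
    have hF' : DependsOn F {t | (t : ℕ) < j + 1 + m} := by convert hF using 4; omega
    simp only [stepsOp]
    rw [h.sum_mul_stepOp, ih (by omega) hF']
    have := dependsOn_stepsOp_lt (p := p) (l := l) (j := j + 1) (m := m) (by omega) hF'
    convert this using 3
    exact Nat.lt_succ_iff.symm

end IsMemoryChain

end Chain

/-- Hoeffding's lemma for a two-point law, with the factor `1/2` in place of the optimal `1/8`. Both
exponentials are bounded by chords, at the parameters `1 - r` and `-r`; their mean under the weights
`r` and `1 - r` loses its `sinh` terms and leaves `cosh (x - y)`. -/
lemma two_point_exp_le {r x y c : ℝ} (hr : r ∈ Set.Icc (0 : ℝ) 1) (hc : |x - y| ≤ c) :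
    r * Real.exp x + (1 - r) * Real.exp y
      ≤ Real.exp (c ^ 2 / 2) * Real.exp (r * x + (1 - r) * y) := by
  obtain ⟨h0, h1⟩ := hr
  have e1 := Real.exp_mul_le_cosh_add_mul_sinh (t := 1 - r) (by rw [abs_le]; constructor <;> linarith)
    (x - y)
  have e2 := Real.exp_mul_le_cosh_add_mul_sinh (t := -r) (by rw [abs_le]; constructor <;> linarith)
    (x - y)
  have e3 := Real.cosh_le_exp_half_sq (x - y)
  have e4 : Real.exp ((x - y) ^ 2 / 2) ≤ Real.exp (c ^ 2 / 2) := by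
    rw [Real.exp_le_exp]
    have := sq_le_sq' (by linarith [abs_nonneg (x - y)] : -c ≤ |x - y|) hc
    rw [sq_abs] at this
    linarith
  have hx : Real.exp x = Real.exp ((1 - r) * (x - y)) * Real.exp (r * x + (1 - r) * y) := by
    rw [← Real.exp_add]; congr 1; ring
  have hy : Real.exp y = Real.exp (-r * (x - y)) * Real.exp (r * x + (1 - r) * y) := by
    rw [← Real.exp_add]; congr 1; ring
  rw [hx, hy, ← mul_assoc, ← mul_assoc, ← add_mul]
  refine mul_le_mul_of_nonneg_right ?_ (Real.exp_pos _).le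
  have a1 := mul_le_mul_of_nonneg_left e1 h0
  have a2 := mul_le_mul_of_nonneg_left e2 (sub_nonneg.2 h1)
  nlinarith

/-! ### Geometric loss of memory under the block lower bound -/

section Chain

variable {N : ℕ}

/-- The value at `t` of a binary path, as a real number. -/
def pathValue (t : Fin N) (b : Fin N → Bool) : ℝ := if b t = true then 1 else 0

lemma pathValue_mem_Icc (t : Fin N) (b : Fin N → Bool) : pathValue t b ∈ Set.Icc (0 : ℝ) 1 := by
  unfold pathValue; split_ifs <;> simp

lemma dependsOn_pathValue (t : Fin N) : DependsOn (pathValue t) {t} := by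
  intro b b' h
  simp [pathValue, h t rfl]

lemma stepsOp_mul_left {q : Fin N → (Fin N → Bool) → ℝ} {j m : ℕ} {S : Set (Fin N)}
    (hS : ∀ t ∈ S, (t : ℕ) < j) {F : (Fin N → Bool) → ℝ} (hF : DependsOn F S)
    (G : (Fin N → Bool) → ℝ) :
    stepsOp q j m (fun b => F b * G b) = fun b => F b * stepsOp q j m G b := by
  induction m generalizing j with
  | zero => rfl
  | succ m ih =>
    simp only [stepsOp]
    rw [ih fun t ht => (hS t ht).trans (Nat.lt_succ_self j)]
    exact stepOp_mul_left (fun t ht => (hS t ht).ne) hF _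

variable {p : (Fin N → Bool) → ℝ} {l : ℕ} {α' : ℝ}

/-- Every block of `l` values has conditional probability at least `α'` given the preceding
block. -/
def BlockLowerBound (p : (Fin N → Bool) → ℝ) (l : ℕ) (α' : ℝ) : Prop :=
  ∀ (s : Fin N) (u v : Fin N → Bool),
    α' * pathProb p (agreeOn {t | (t : ℕ) + l ≤ s ∧ (s : ℕ) < t + 2 * l} v)
      ≤ pathProb p (agreeOn {t | t ≤ s ∧ (s : ℕ) < t + l} u ∩
          agreeOn {t | (t : ℕ) + l ≤ s ∧ (s : ℕ) < t + 2 * l} v)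

namespace IsMemoryChain

lemma exists_pos (h : IsMemoryChain p l) : ∃ b, 0 < p b := by
  by_contra! hc
  have : ∑ b, p b ≤ 0 := Finset.sum_nonpos fun b _ => hc b
  rw [h.sum_eq_one] at this
  linarith

/-- Ensures that conditioning on a window of the last `l` values is never degenerate, so the
transition estimates hold for every path and not just for almost every one. -/
lemma pathProb_window_pos (h : IsMemoryChain p l) (hα : 0 < α') (hb : BlockLowerBound p l α')
    {j : ℕ} (hj : j ≤ N) (u : Fin N → Bool) :
    0 < pathProb p (agreeOn {t | (t : ℕ) < j ∧ j ≤ t + l} u) := by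
  obtain ⟨v, hv⟩ := h.exists_pos
  rcases Nat.eq_zero_or_pos j with rfl | hj0
  · exact hv.trans_le (le_pathProb h.nonneg fun t ht => absurd ht.1 (by omega))
  · have h1 := hb ⟨j - 1, by omega⟩ u v
    have h2 := le_pathProb h.nonneg (self_mem_agreeOn {t : Fin N | (t : ℕ) + l ≤ j - 1 ∧
      j - 1 < (t : ℕ) + 2 * l} v)
    have h3 := pathProb_mono h.nonneg (Set.inter_subset_left
      (s := agreeOn {t : Fin N | t ≤ ⟨j - 1, by omega⟩ ∧ j - 1 < (t : ℕ) + l} u)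
      (t := agreeOn {t : Fin N | (t : ℕ) + l ≤ j - 1 ∧ j - 1 < (t : ℕ) + 2 * l} v))
    have h4 : {t : Fin N | t ≤ ⟨j - 1, by omega⟩ ∧ j - 1 < (t : ℕ) + l}
        = {t : Fin N | (t : ℕ) < j ∧ j ≤ t + l} := by
      ext t
      simp only [Set.mem_ofPred_eq, Fin.le_def]
      omega
    rw [h4] at h1 h3
    have h5 := mul_pos hα (hv.trans_le h2)
    exact h5.trans_le (h1.trans h3)

/-- The `l`-step transition probabilities are at least `α'`. -/
lemma le_stepsOp_indicator (h : IsMemoryChain p l) (hl : 1 ≤ l) (hα : 0 < α')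
    (hb : BlockLowerBound p l α') {j : ℕ} (hj : j + l ≤ N) (u b : Fin N → Bool) :
    α' ≤ stepsOp (transProb p l) j l
      ((agreeOn {t | (t : ℕ) < j + l ∧ j + l ≤ t + l} u).indicator fun _ => 1) b := by
  set W : Set (Fin N) := {t | (t : ℕ) < j ∧ j ≤ t + l} with hW
  set V : Set (Fin N) := {t | (t : ℕ) < j + l ∧ j + l ≤ t + l} with hV
  set J : (Fin N → Bool) → ℝ := (agreeOn V u).indicator fun _ => 1 with hJ
  set J₀ : (Fin N → Bool) → ℝ := (agreeOn W b).indicator fun _ => 1 with hJ₀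
  have dep : ∀ (S : Set (Fin N)) (c : Fin N → Bool),
      DependsOn ((agreeOn S c).indicator (fun _ => (1 : ℝ))) S := by
    intro S c x y hxy
    have : x ∈ agreeOn S c ↔ y ∈ agreeOn S c := forall₂_congr fun t ht => by rw [hxy t ht]
    by_cases hx : x ∈ agreeOn S c
    · rw [Set.indicator_of_mem hx, Set.indicator_of_mem (this.1 hx)]
    · rw [Set.indicator_of_notMem hx, Set.indicator_of_notMem fun hy => hx (this.2 hy)]
  have hIJ : ∑ x, p x * (J₀ x * J x) = pathProb p (agreeOn V u ∩ agreeOn W b) := by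
    rw [pathProb_eq_sum_mul]
    refine Finset.sum_congr rfl fun x _ => ?_
    by_cases h1 : x ∈ agreeOn W b <;> by_cases h2 : x ∈ agreeOn V u <;> simp [hJ₀, hJ, h1, h2]
  have hdepIJ : DependsOn (fun x => J₀ x * J x) {t | (t : ℕ) < j + l} := by
    intro x y hxy
    have e1 : J₀ x = J₀ y := dep W b fun t ht => hxy t (by have := ht.1; simp; omega)
    have e2 : J x = J y := dep V u fun t ht => hxy t ht.1
    simp only [e1, e2]
  have h1 := h.sum_mul_stepsOp hj hdepIJ
  -- The indicator of the earlier window passes through the `l` steps. What remains depends only on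
  -- that window, hence is constant on it, and the window probability can be cancelled.
  rw [stepsOp_mul_left (fun t ht => ht.1) (dep W b) J, hIJ] at h1
  have hdepK : DependsOn (stepsOp (transProb p l) j l J) W :=
    dependsOn_stepsOp (dependsOn_transProb p l) hj (dep V u)
  have h2 : ∑ x, p x * (J₀ x * stepsOp (transProb p l) j l J x)
      = stepsOp (transProb p l) j l J b * pathProb p (agreeOn W b) := by
    rw [pathProb_eq_sum_mul, Finset.mul_sum]
    refine Finset.sum_congr rfl fun x _ => ?_
    by_cases hx : x ∈ agreeOn W b
    · rw [hdepK hx]; ring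
    · simp [hJ₀, hx]
  have h3 := hb ⟨j + l - 1, by omega⟩ u b
  have e1 : {t : Fin N | t ≤ ⟨j + l - 1, by omega⟩ ∧ j + l - 1 < (t : ℕ) + l} = V := by
    ext t
    simp only [Set.mem_ofPred_eq, Fin.le_def, hV]
    omega
  have e2 : {t : Fin N | (t : ℕ) + l ≤ j + l - 1 ∧ j + l - 1 < (t : ℕ) + 2 * l} = W := by
    ext t
    simp only [Set.mem_ofPred_eq, hW]
    omega
  rw [e1, e2] at h3
  have hpos := h.pathProb_window_pos hα hb (j := j) (by omega) b
  rw [← h1, h2] at h3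
  exact le_of_mul_le_mul_right h3 hpos

/-- A block of `l` steps contracts the oscillation by the factor `1 - 2α'`. -/
lemma stepsOp_sub_le (h : IsMemoryChain p l) (hl : 1 ≤ l) (hα : 0 < α') (hα2 : α' ≤ 1 / 2)
    (hb : BlockLowerBound p l α') {j : ℕ} (hj : j + l ≤ N) {F : (Fin N → Bool) → ℝ}
    (hF : DependsOn F {t | (t : ℕ) < j + l ∧ j + l ≤ t + l}) {D : ℝ}
    (hD : ∀ x y, F x - F y ≤ D) (x y : Fin N → Bool) :
    stepsOp (transProb p l) j l F x - stepsOp (transProb p l) j l F y ≤ (1 - 2 * α') * D := by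
  obtain ⟨u, hu⟩ := Finite.exists_max F
  obtain ⟨v, hv⟩ := Finite.exists_min F
  set V : Set (Fin N) := {t | (t : ℕ) < j + l ∧ j + l ≤ t + l}
  have hR : 0 ≤ F u - F v := sub_nonneg.2 (hv u)
  have k1 := h.le_stepsOp_indicator hl hα hb hj v x
  have k2 := h.le_stepsOp_indicator hl hα hb hj u y
  -- Doeblin's argument: the block of the minimizer `v` receives mass at least `α'` from `x`, and
  -- that of the maximizer `u` at least `α'` from `y`. Each removes `α' * (F u - F v)` from the gap.
  have m1 := stepsOp_mono h.transProb_mem_Icc j l (F := F)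
    (G := fun b => F u + (-(F u - F v)) * (agreeOn V v).indicator (fun _ => 1) b) (fun b => by
      by_cases hbv : b ∈ agreeOn V v
      · simp [hbv, hF hbv]
      · simp [hbv, hu b]) x
  have m2 := stepsOp_mono h.transProb_mem_Icc j l (G := F)
    (F := fun b => F v + (F u - F v) * (agreeOn V u).indicator (fun _ => 1) b) (fun b => by
      by_cases hbv : b ∈ agreeOn V u
      · simp [hbv, hF hbv]
      · simp [hbv, hv b]) y
  rw [stepsOp_add, stepsOp_const, stepsOp_const_mul] at m1 m2
  have n1 := mul_le_mul_of_nonneg_left k1 hR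
  have n2 := mul_le_mul_of_nonneg_left k2 hR
  have n3 := mul_le_mul_of_nonneg_left (hD u v) (by linarith : 0 ≤ 1 - 2 * α')
  have m1' : stepsOp (transProb p l) j l F x ≤ F u - (F u - F v) * α' := by
    refine m1.trans ?_
    simp only [neg_mul]
    linarith
  have m2' : F v + (F u - F v) * α' ≤ stepsOp (transProb p l) j l F y := by
    refine le_trans ?_ m2
    simp only
    linarith
  nlinarith

lemma stepsOp_mul_sub_le (h : IsMemoryChain p l) (hl : 1 ≤ l) (hα : 0 < α') (hα2 : α' ≤ 1 / 2)
    (hb : BlockLowerBound p l α') {j m : ℕ} (hj : j + m * l ≤ N) {F : (Fin N → Bool) → ℝ}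
    (hF : DependsOn F {t | (t : ℕ) < j + m * l ∧ j + m * l ≤ t + l}) {D : ℝ}
    (hD : ∀ x y, F x - F y ≤ D) (x y : Fin N → Bool) :
    stepsOp (transProb p l) j (m * l) F x - stepsOp (transProb p l) j (m * l) F y
      ≤ (1 - 2 * α') ^ m * D := by
  induction m generalizing j x y with
  | zero => simpa [stepsOp] using hD x y
  | succ m ih =>
    have e : j + l + m * l = j + (m + 1) * l := by ring
    have e' : (m + 1) * l = l + m * l := by ring
    have hF' : DependsOn F {t | (t : ℕ) < j + l + m * l ∧ j + l + m * l ≤ t + l} := by rwa [e]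
    have h1 := ih (j := j + l) (by omega) hF'
    have h2 := dependsOn_stepsOp (dependsOn_transProb p l) (j := j + l) (m := m * l)
      (by omega) hF'
    have h3 := h.stepsOp_sub_le hl hα hα2 hb (by omega) h2 h1 x y
    rw [stepsOp_stepsOp, ← e'] at h3
    rw [pow_succ']
    linarith

lemma stepsOp_pathValue (q : Fin N → (Fin N → Bool) → ℝ) {j : ℕ} (t : Fin N) (hj : j ≤ t + 1) :
    stepsOp q j (N - j) (pathValue t) = stepsOp q j (t + 1 - j) (pathValue t) := by
  have e : N - j = (t + 1 - j) + (N - (t + 1)) := by omega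
  rw [e, ← stepsOp_stepsOp]
  congr 1
  exact stepsOp_of_dependsOn (S := {t}) (by simp; omega) (dependsOn_pathValue t)

/-- The dependence of the conditional mean of the value at `t` on the values up to `s < t` decays
geometrically. -/
lemma stepsOp_pathValue_sub_le (h : IsMemoryChain p l) (hl : 1 ≤ l) (hα : 0 < α')
    (hα2 : α' ≤ 1 / 2) (hb : BlockLowerBound p l α') {s t : Fin N} (hst : s < t)
    (x y : Fin N → Bool) :
    stepsOp (transProb p l) (s + 1) (N - (s + 1)) (pathValue t) x
      - stepsOp (transProb p l) (s + 1) (N - (s + 1)) (pathValue t) y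
      ≤ (1 - 2 * α') ^ (((t : ℕ) - s) / l) := by
  have hst' : (s : ℕ) < t := hst
  set m := ((t : ℕ) - s) / l with hm
  have hml : m * l ≤ t - s := Nat.div_mul_le_self _ _
  rw [stepsOp_pathValue _ _ (by omega)]
  -- The `t - s` steps are `m` full blocks followed by a remainder. The remainder acts first on
  -- `pathValue t`, keeps it in `[0, 1]`, and leaves a function of one window, to which the
  -- contraction applies `m` times.
  have e : (t : ℕ) + 1 - (s + 1) = m * l + (t - s - m * l) := by omega
  have h1 : DependsOn (stepsOp (transProb p l) (s + 1 + m * l) (t - s - m * l) (pathValue t))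
      {r | (r : ℕ) < s + 1 + m * l ∧ s + 1 + m * l ≤ r + l} := by
    refine dependsOn_stepsOp (dependsOn_transProb p l) (by omega) ?_
    intro b b' hbb
    refine dependsOn_pathValue t fun r hr => hbb r ?_
    rw [Set.mem_singleton_iff.1 hr]
    constructor <;> omega
  have h2 : ∀ x, stepsOp (transProb p l) (s + 1 + m * l) (t - s - m * l) (pathValue t) x
      ∈ Set.Icc (0 : ℝ) 1 :=
    stepsOp_mem_Icc h.transProb_mem_Icc _ _ (pathValue_mem_Icc t)
  have h3 := h.stepsOp_mul_sub_le hl hα hα2 hb (by omega) h1 (D := 1)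
    (fun x y => by linarith [(h2 x).2, (h2 y).1]) x y
  rw [stepsOp_stepsOp, ← e, mul_one] at h3
  exact h3

/-- Without memory the window is empty, so the conditional mean after one step is already constant.
-/
lemma stepsOp_pathValue_eq (p : (Fin N → Bool) → ℝ) {s t : Fin N} (hst : s < t)
    (x y : Fin N → Bool) :
    stepsOp (transProb p 0) (s + 1) (N - (s + 1)) (pathValue t) x
      = stepsOp (transProb p 0) (s + 1) (N - (s + 1)) (pathValue t) y := by
  have hst' : (s : ℕ) < t := hst
  rw [stepsOp_pathValue _ _ (by omega)]
  have e : (t : ℕ) + 1 - (s + 1) = (t - s - 1) + 1 := by omega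
  rw [e, ← stepsOp_stepsOp]
  have e2 : (s : ℕ) + 1 + (t - s - 1) = t := by omega
  have h1 : DependsOn (stepsOp (transProb p 0) ((s : ℕ) + 1 + (t - s - 1)) 1 (pathValue t))
      {r | (r : ℕ) < (s : ℕ) + 1 + (t - s - 1) ∧ (s : ℕ) + 1 + (t - s - 1) ≤ r + 0} := by
    rw [e2]
    refine (dependsOn_pathValue t).stepOp (dependsOn_transProb p 0) ?_ ?_ t.2
    · intro r hr hrt
      exact absurd (congrArg Fin.val (Set.mem_singleton_iff.1 hr)) hrt
    · intro r h1 h2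
      exact ⟨h1, h2⟩
  have h2 := dependsOn_stepsOp (dependsOn_transProb p 0) (by omega) h1
  exact h2 fun r hr => absurd hr.1 (by have := hr.2; omega)

end IsMemoryChain

end Chain

/-- Schur's test: Cauchy–Schwarz with weights `Δ i j` uses the row sums, and exchanging the sums
uses the column sums. It is what keeps the variance factor free of `N`. -/
lemma sum_sq_sum_mul_le {ι κ : Type*} [Fintype ι] [Fintype κ] (Δ : ι → κ → ℝ) (w : κ → ℝ) {K : ℝ}
    (hΔ : ∀ i j, 0 ≤ Δ i j) (hrow : ∀ i, ∑ j, Δ i j ≤ K) (hcol : ∀ j, ∑ i, Δ i j ≤ K)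
    (hK : 0 ≤ K) :
    ∑ i, (∑ j, w j * Δ i j) ^ 2 ≤ K ^ 2 * ∑ j, w j ^ 2 := by
  have h1 : ∀ i, (∑ j, w j * Δ i j) ^ 2 ≤ K * ∑ j, w j ^ 2 * Δ i j := by
    intro i
    have := Finset.sum_sq_le_sum_mul_sum_of_sq_le_mul Finset.univ (r := fun j => w j * Δ i j)
      (f := fun j => Δ i j) (g := fun j => w j ^ 2 * Δ i j) (fun j _ => hΔ i j)
      (fun j _ => mul_nonneg (sq_nonneg _) (hΔ i j)) (fun j _ => le_of_eq (by ring))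
    exact this.trans (mul_le_mul_of_nonneg_right (hrow i)
      (Finset.sum_nonneg fun j _ => mul_nonneg (sq_nonneg _) (hΔ i j)))
  calc ∑ i, (∑ j, w j * Δ i j) ^ 2 ≤ ∑ i, K * ∑ j, w j ^ 2 * Δ i j :=
        Finset.sum_le_sum fun i _ => h1 i
    _ = K * ∑ j, w j ^ 2 * ∑ i, Δ i j := by
        rw [← Finset.mul_sum, Finset.sum_comm]
        simp_rw [Finset.mul_sum]
    _ ≤ K * ∑ j, w j ^ 2 * K := by gcongr with j; exact hcol j
    _ = K ^ 2 * ∑ j, w j ^ 2 := by rw [← Finset.sum_mul]; ring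

lemma sum_fin_comp_le {N : ℕ} {δ : ℕ → ℝ} (hδ : ∀ m, 0 ≤ δ m) (φ : Fin N → ℕ)
    (T : Finset (Fin N)) (hinj : Set.InjOn φ T) (hlt : ∀ t ∈ T, φ t < N) :
    ∑ t ∈ T, δ (φ t) ≤ ∑ m ∈ Finset.range N, δ m := by
  rw [← Finset.sum_image (s := T) (g := φ) (f := δ) hinj]
  refine Finset.sum_le_sum_of_subset_of_nonneg ?_ fun m _ _ => hδ m
  intro m hm
  obtain ⟨t, ht, rfl⟩ := Finset.mem_image.1 hm
  exact Finset.mem_range.2 (hlt t ht)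

/-- Every exponent occurs `l` times, so this is `l` copies of a geometric series. -/
lemma sum_pow_div_le {ρ : ℝ} (h0 : 0 ≤ ρ) (h1 : ρ < 1) {l : ℕ} (hl : 1 ≤ l) (N : ℕ) :
    ∑ m ∈ Finset.range N, ρ ^ (m / l) ≤ l / (1 - ρ) := by
  have e : ∀ N, ∑ m ∈ Finset.range (l * N), ρ ^ (m / l) = l * ∑ i ∈ Finset.range N, ρ ^ i := by
    intro N
    induction N with
    | zero => simp
    | succ N ih =>
      rw [Nat.mul_succ, Finset.sum_range_add, ih, Finset.sum_range_succ, mul_add]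
      congr 1
      rw [Finset.sum_congr rfl (g := fun _ => ρ ^ N)]
      · simp
      · intro x hx
        rw [Nat.mul_add_div (by omega), Nat.div_eq_of_lt (Finset.mem_range.1 hx), add_zero]
  calc ∑ m ∈ Finset.range N, ρ ^ (m / l) ≤ ∑ m ∈ Finset.range (l * N), ρ ^ (m / l) :=
        Finset.sum_le_sum_of_subset_of_nonneg
          (Finset.range_subset_range.2 (Nat.le_mul_of_pos_left N (by omega)))
          fun m _ _ => by positivity
    _ = l * ∑ i ∈ Finset.range N, ρ ^ i := e N
    _ ≤ l / (1 - ρ) := by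
        rw [div_eq_mul_inv]
        gcongr
        rw [← one_div, le_div_iff₀ (by linarith), mul_comm, mul_neg_geom_sum]
        linarith [pow_nonneg h0 N]

/-! ### Sub-Gaussian linear forms by martingale differences -/

section Chain

variable {N : ℕ} {p : (Fin N → Bool) → ℝ} {l : ℕ} {α' : ℝ}

namespace IsMemoryChain

/-- The martingale bound: if the influence of the values up to `s` on the conditional mean of the
value at `t` is at most `δ (t - s)`, then linear forms of the path are sub-Gaussian. -/
lemma sum_mul_exp_le (h : IsMemoryChain p l) {δ : ℕ → ℝ} {K : ℝ} (hδ : ∀ m, 0 ≤ δ m)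
    (hδ0 : 1 ≤ δ 0)
    (hinfl : ∀ s t : Fin N, s < t → ∀ x y,
      stepsOp (transProb p l) (s + 1) (N - (s + 1)) (pathValue t) x
        - stepsOp (transProb p l) (s + 1) (N - (s + 1)) (pathValue t) y ≤ δ (t - s))
    (hsum : ∑ m ∈ Finset.range N, δ m ≤ K) (w θ : Fin N → ℝ)
    (hθ : ∀ t, ∑ b, p b * pathValue t b = θ t) :
    ∑ b, p b * Real.exp (∑ t, w t * (pathValue t b - θ t))
      ≤ Real.exp (K ^ 2 * (∑ t, w t ^ 2) / 2) := by
  set q := transProb p l with hq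
  set F : (Fin N → Bool) → ℝ := fun b => ∑ t, w t * pathValue t b with hF
  set Δ : Fin N → Fin N → ℝ := fun s t => if s ≤ t then δ (t - s) else 0 with hΔ
  set c : Fin N → ℝ := fun s => ∑ t, |w t| * Δ s t with hc
  have hK : 0 ≤ K := (Finset.sum_nonneg fun m _ => hδ m).trans hsum
  have hΔ0 : ∀ s t, 0 ≤ Δ s t := fun s t => by simp only [hΔ]; split_ifs; exacts [hδ _, le_rfl]
  have hcsq : ∑ s, c s ^ 2 ≤ K ^ 2 * ∑ t, w t ^ 2 := by
    have := sum_sq_sum_mul_le Δ (fun t => |w t|) (K := K) hΔ0 ?_ ?_ hK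
    · simpa only [sq_abs] using this
    · intro s
      simp only [hΔ]
      rw [← Finset.sum_filter]
      refine (sum_fin_comp_le hδ (fun t : Fin N => (t : ℕ) - s) _ ?_ ?_).trans hsum
      · intro t ht t' ht' htt
        simp only [Finset.coe_filter, Finset.mem_univ, true_and, Set.mem_ofPred_eq,
          Fin.le_def] at ht ht' htt
        exact Fin.ext (by omega)
      · intro t _; omega
    · intro t
      simp only [hΔ]
      rw [← Finset.sum_filter]
      refine (sum_fin_comp_le hδ (fun s : Fin N => (t : ℕ) - s) _ ?_ ?_).trans hsum
      · intro s hs s' hs' hss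
        simp only [Finset.coe_filter, Finset.mem_univ, true_and, Set.mem_ofPred_eq,
          Fin.le_def] at hs hs' hss
        exact Fin.ext (by omega)
      · intro s _; omega
  have hdepF : ∀ j, j ≤ N → DependsOn F {t | (t : ℕ) < j + (N - j)} := by
    intro j hj x y hxy
    have : x = y := funext fun t => hxy t (by simp; omega)
    rw [this]
  have hG : ∀ j, stepsOp q j (N - j) F
      = fun b => ∑ t, w t * stepsOp q j (N - j) (pathValue t) b := by
    intro j
    rw [hF, stepsOp_sum]
    simp_rw [stepsOp_const_mul]
  -- `c s` bounds the martingale increment at `s`. Later terms contribute through `hinfl`, the term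
  -- `t = s` contributes at most `|w s|` and uses `1 ≤ δ 0`, and earlier terms do not change.
  have hdiff : ∀ (s : Fin N) (b : Fin N → Bool),
      |stepsOp q (s + 1) (N - (s + 1)) F (Function.update b s true)
        - stepsOp q (s + 1) (N - (s + 1)) F (Function.update b s false)| ≤ c s := by
    intro s b
    rw [hG]
    simp only
    rw [← Finset.sum_sub_distrib]
    refine (Finset.abs_sum_le_sum_abs _ _).trans (Finset.sum_le_sum fun t _ => ?_)
    rw [← mul_sub, abs_mul]
    refine mul_le_mul_of_nonneg_left ?_ (abs_nonneg _)
    rcases lt_or_ge s t with hst | hst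
    · simp only [hΔ, hst.le, if_true]
      rw [abs_le]
      constructor <;> linarith [hinfl s t hst (Function.update b s true) (Function.update b s false),
        hinfl s t hst (Function.update b s false) (Function.update b s true)]
    · have hts : (t : ℕ) ≤ s := hst
      rw [stepsOp_of_dependsOn (S := {t}) (by simp; omega) (dependsOn_pathValue t)]
      rcases hst.eq_or_lt with rfl | hlt
      · simpa [hΔ, pathValue] using hδ0
      · simp [hΔ, hlt.not_ge, pathValue, Function.update_of_ne hlt.ne]
  -- Induction along the Doob martingale `stepsOp q j (N - j) F`, the conditional mean of `F` given
  -- the first `j` values. It starts at the mean of `F` and ends at `F`; each step costs a factor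
  -- `exp (c s ^ 2 / 2)`.
  have hstep : ∀ j, j ≤ N → ∑ b, p b * Real.exp (stepsOp q j (N - j) F b)
      ≤ Real.exp ((∑ s ∈ Finset.univ.filter (fun s : Fin N => (s : ℕ) < j), c s ^ 2) / 2) * Real.exp (∑ b, p b * F b) := by
    intro j hj
    induction j with
    | zero =>
      have hdep := dependsOn_stepsOp_lt (p := p) (l := l) (j := 0) (m := N - 0) (by omega)
        (hdepF 0 (by omega))
      have hconst : ∀ x y, stepsOp q 0 (N - 0) F x = stepsOp q 0 (N - 0) F y := fun x y =>
        hdep fun t ht => absurd ht (Nat.not_lt_zero _)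
      have hmean := h.sum_mul_stepsOp (j := 0) (m := N - 0) (by omega) (hdepF 0 (by omega))
      have hval : ∀ x, stepsOp q 0 (N - 0) F x = ∑ b, p b * F b := by
        intro x
        rw [← hmean, Finset.sum_congr rfl fun b _ => by rw [← hq, hconst b x], ← Finset.sum_mul,
          h.sum_eq_one, one_mul]
      rw [Finset.sum_congr rfl fun b _ => by rw [hval b], ← Finset.sum_mul, h.sum_eq_one]
      simp
    | succ j ih =>
      have hjN : j < N := hj
      have hdep := dependsOn_stepsOp_lt (p := p) (l := l) (j := j + 1) (m := N - (j + 1))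
        (by omega) (hdepF (j + 1) hj)
      have hdep' : DependsOn (fun b => Real.exp (stepsOp q (j + 1) (N - (j + 1)) F b))
          {t | (t : ℕ) ≤ j} := fun x y hxy => by
        have := hdep (x := x) (y := y) fun t ht => hxy t (Nat.lt_succ_iff.1 ht)
        simp only [hq, this]
      have hbase : stepsOp q j (N - j) F = stepOp q j (stepsOp q (j + 1) (N - (j + 1)) F) := by
        have : N - j = (N - (j + 1)) + 1 := by omega
        rw [this]; rfl
      have hfilter : (Finset.univ.filter fun s : Fin N => (s : ℕ) < j + 1)
          = insert ⟨j, hjN⟩ (Finset.univ.filter fun s : Fin N => (s : ℕ) < j) := by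
        ext s
        simp only [Finset.mem_filter, Finset.mem_univ, true_and, Finset.mem_insert, Fin.ext_iff]
        omega
      rw [← h.sum_mul_stepOp j hdep', hfilter, Finset.sum_insert (by simp), add_div, Real.exp_add,
        mul_assoc]
      refine le_trans ?_ (mul_le_mul_of_nonneg_left (ih (by omega)) (Real.exp_pos _).le)
      rw [Finset.mul_sum]
      refine Finset.sum_le_sum fun b _ => ?_
      rw [mul_left_comm]
      refine mul_le_mul_of_nonneg_left ?_ (h.nonneg b)
      rw [hbase]
      simp only [stepOp, hjN, dif_pos]
      exact two_point_exp_le (h.transProb_mem_Icc _ _) (hdiff ⟨j, hjN⟩ b)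
  have hfin := hstep N le_rfl
  have hmean : ∑ b, p b * F b = ∑ t, w t * θ t := by
    simp only [hF, Finset.mul_sum]
    rw [Finset.sum_comm]
    refine Finset.sum_congr rfl fun t _ => ?_
    rw [← hθ, Finset.mul_sum]
    exact Finset.sum_congr rfl fun b _ => by ring
  have hid : stepsOp q N (N - N) F = F := by simp [stepsOp]
  rw [hid, hmean] at hfin
  have e1 : ∑ b, p b * Real.exp (∑ t, w t * (pathValue t b - θ t))
      = (∑ b, p b * Real.exp (F b)) * Real.exp (-∑ t, w t * θ t) := by
    rw [Finset.sum_mul]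
    refine Finset.sum_congr rfl fun b _ => ?_
    rw [mul_assoc, ← Real.exp_add]
    simp only [hF, mul_sub, Finset.sum_sub_distrib]
    rw [sub_eq_add_neg]
  rw [e1]
  calc (∑ b, p b * Real.exp (F b)) * Real.exp (-∑ t, w t * θ t)
      ≤ (Real.exp ((∑ s ∈ Finset.univ.filter (fun s : Fin N => (s : ℕ) < N), c s ^ 2) / 2) * Real.exp (∑ t, w t * θ t))
        * Real.exp (-∑ t, w t * θ t) := by gcongr
    _ = Real.exp ((∑ s, c s ^ 2) / 2) := by
        rw [mul_assoc, ← Real.exp_add, add_neg_cancel, Real.exp_zero, mul_one]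
        simp
    _ ≤ _ := by gcongr

/-- Linear forms of a mixing chain with memory `l ≥ 1` are sub-Gaussian. -/
lemma sum_mul_exp_le_of_blockLowerBound (h : IsMemoryChain p l) (hl : 1 ≤ l) (hα : 0 < α')
    (hα2 : α' ≤ 1 / 2) (hb : BlockLowerBound p l α') (w θ : Fin N → ℝ)
    (hθ : ∀ t, ∑ b, p b * pathValue t b = θ t) :
    ∑ b, p b * Real.exp (∑ t, w t * (pathValue t b - θ t))
      ≤ Real.exp ((l / (2 * α')) ^ 2 * (∑ t, w t ^ 2) / 2) := by
  refine h.sum_mul_exp_le (δ := fun m => (1 - 2 * α') ^ (m / l)) (fun m => pow_nonneg (by linarith) _)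
    (by simp) (fun s t hst x y => h.stepsOp_pathValue_sub_le hl hα hα2 hb hst x y) ?_ w θ hθ
  have := sum_pow_div_le (ρ := 1 - 2 * α') (by linarith) (by linarith) hl N
  rwa [sub_sub_cancel] at this

/-- Linear forms of a chain without memory are sub-Gaussian. -/
lemma sum_mul_exp_le_of_memory_zero (h : IsMemoryChain p 0) (w θ : Fin N → ℝ)
    (hθ : ∀ t, ∑ b, p b * pathValue t b = θ t) :
    ∑ b, p b * Real.exp (∑ t, w t * (pathValue t b - θ t))
      ≤ Real.exp (1 ^ 2 * (∑ t, w t ^ 2) / 2) := by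
  refine h.sum_mul_exp_le (δ := fun m => if m = 0 then 1 else 0)
    (fun m => by split_ifs <;> simp) (by simp) (fun s t hst x y => ?_) ?_ w θ hθ
  · rw [stepsOp_pathValue_eq p hst x y, sub_self]
    split_ifs <;> simp
  · rw [Finset.sum_ite_eq']
    split_ifs <;> simp

end IsMemoryChain

end Chain

/-! ### Sub-Gaussian noise and least squares -/

lemma integral_exp_mul_gaussianReal (r : ℝ) :
    ∫ x, Real.exp (r * x) ∂(gaussianReal 0 1) = Real.exp (r ^ 2 / 2) := by
  have := mgf_gaussianReal (p := gaussianReal 0 1) (X := id) (μ := 0) (v := 1) (by simp) r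
  simpa [mgf] using this

lemma integral_exp_sq_gaussianReal :
    ∫ x, Real.exp (x ^ 2 / 4) ∂(gaussianReal 0 1) = √2 := by
  rw [integral_gaussianReal_eq_integral_smul (by norm_num)]
  have h : ∀ x : ℝ, gaussianPDFReal 0 1 x • Real.exp (x ^ 2 / 4)
      = (√(2 * Real.pi))⁻¹ * Real.exp (-(1 / 4) * x ^ 2) := by
    intro x
    simp only [gaussianPDFReal, smul_eq_mul, NNReal.coe_one, mul_one, sub_zero]
    rw [mul_assoc, ← Real.exp_add]
    congr 2
    ring
  simp_rw [h]
  rw [integral_const_mul, integral_gaussian, ← Real.sqrt_inv, ← Real.sqrt_mul (by positivity)]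
  congr 1
  have := Real.pi_pos.ne'
  field_simp
  norm_num

section Noise

variable {E S : Type*} [Fintype E] [Fintype S] {β : Type*} [Fintype β]

/-- Quadratic forms of sub-Gaussian vectors, by integration against a Gaussian vector. -/
lemma sum_mul_exp_sum_sq_le {p : β → ℝ} {ε : β → E → ℝ} {K : ℝ} (hK : 0 < K)
    (hε : ∀ w : E → ℝ, ∑ b, p b * Real.exp (∑ e, w e * ε b e)
      ≤ Real.exp (K ^ 2 * (∑ e, w e ^ 2) / 2))
    (u : S → E → ℝ) (hu : ∀ g : S → ℝ, ∑ e, (∑ s, g s * u s e) ^ 2 ≤ ∑ s, g s ^ 2) :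
    ∑ b, p b * Real.exp ((∑ s, (∑ e, u s e * ε b e) ^ 2) / (4 * K ^ 2))
      ≤ √2 ^ Fintype.card S := by
  -- With `τ ^ 2 = 1 / (2 K ^ 2)` the Gaussian integral of `exp (τ x g)` is `exp (x ^ 2 / (4 K ^
  -- 2))`. After exchanging sum and integral, the sub-Gaussian bound leaves `exp (|g| ^ 2 / 4)`,
  -- still integrable for the standard Gaussian.
  set τ : ℝ := (√2 * K)⁻¹ with hτ
  have hτ2 : τ ^ 2 = (2 * K ^ 2)⁻¹ := by
    rw [hτ, inv_pow, mul_pow, Real.sq_sqrt (by norm_num)]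
  set γ : Measure (S → ℝ) := Measure.pi fun _ => gaussianReal 0 1 with hγ
  have hint1 : ∀ x : S → ℝ, Integrable (fun g : S → ℝ => ∏ s, Real.exp (τ * x s * g s)) γ := by
    intro x
    refine Integrable.fintype_prod (f := fun s y => Real.exp (τ * x s * y)) fun s => ?_
    exact integrable_exp_mul_gaussianReal _
  have hint2 : Integrable (fun g : S → ℝ => ∏ s, Real.exp (g s ^ 2 / 4)) γ := by
    refine Integrable.fintype_prod (f := fun _ y => Real.exp (y ^ 2 / 4)) fun s => ?_
    refine .of_integral_ne_zero ?_
    rw [integral_exp_sq_gaussianReal]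
    positivity
  have hval1 : ∀ x : S → ℝ, ∫ g, ∏ s, Real.exp (τ * x s * g s) ∂γ
      = Real.exp ((∑ s, x s ^ 2) / (4 * K ^ 2)) := by
    intro x
    rw [hγ, integral_fintype_prod_eq_prod (f := fun s y => Real.exp (τ * x s * y))]
    simp_rw [integral_exp_mul_gaussianReal]
    rw [← Real.exp_sum, Finset.sum_div]
    congr 1
    refine Finset.sum_congr rfl fun s _ => ?_
    rw [mul_pow, hτ2]
    field_simp
    ring
  have hval2 : ∫ g, ∏ s, Real.exp (g s ^ 2 / 4) ∂γ = √2 ^ Fintype.card S := by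
    rw [hγ, integral_fintype_prod_eq_prod (f := fun (_ : S) y => Real.exp (y ^ 2 / 4))]
    simp_rw [integral_exp_sq_gaussianReal]
    simp
  have hle : ∀ g : S → ℝ, ∑ b, p b * ∏ s, Real.exp (τ * (∑ e, u s e * ε b e) * g s)
      ≤ ∏ s, Real.exp (g s ^ 2 / 4) := by
    intro g
    have h1 := hε fun e => τ * ∑ s, g s * u s e
    have e1 : ∀ b, ∏ s, Real.exp (τ * (∑ e, u s e * ε b e) * g s)
        = Real.exp (∑ e, (τ * ∑ s, g s * u s e) * ε b e) := by
      intro b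
      rw [← Real.exp_sum]
      congr 1
      simp only [Finset.mul_sum, Finset.sum_mul]
      rw [Finset.sum_comm]
      exact Finset.sum_congr rfl fun e _ => Finset.sum_congr rfl fun s _ => by ring
    simp_rw [e1]
    refine h1.trans ?_
    rw [← Real.exp_sum, Real.exp_le_exp]
    have h2 := hu g
    simp_rw [mul_pow, ← Finset.mul_sum]
    rw [hτ2, ← Finset.sum_div]
    have : K ^ 2 * ((2 * K ^ 2)⁻¹ * ∑ e, (∑ s, g s * u s e) ^ 2) / 2
        = (∑ e, (∑ s, g s * u s e) ^ 2) / 4 := by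
      field_simp
      ring
    rw [this]
    linarith
  calc ∑ b, p b * Real.exp ((∑ s, (∑ e, u s e * ε b e) ^ 2) / (4 * K ^ 2))
      = ∑ b, p b * ∫ g, ∏ s, Real.exp (τ * (∑ e, u s e * ε b e) * g s) ∂γ := by
        simp_rw [hval1 fun s => ∑ e, u s e * ε _ e]
    _ = ∫ g, ∑ b, p b * ∏ s, Real.exp (τ * (∑ e, u s e * ε b e) * g s) ∂γ := by
        rw [integral_finsetSum _ fun b _ => (hint1 fun s => ∑ e, u s e * ε b e).const_mul _]
        simp_rw [integral_const_mul]
    _ ≤ ∫ g, ∏ s, Real.exp (g s ^ 2 / 4) ∂γ :=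
        integral_mono (integrable_finsetSum _ fun b _ =>
          (hint1 fun s => ∑ e, u s e * ε b e).const_mul _) hint2 hle
    _ = _ := hval2

variable {Z : Type*} [DecidableEq S]

/-- The event on which the noise `a - θ` is under control, uniformly over the labellings `ζ z` and
the approximations `η z`. -/
def NoiseBounded (ζ : Z → E → S) (η : Z → E → ℝ) (K t : ℝ) (θ a : E → ℝ) : Prop :=
  (∀ z, ∑ e, (blockAverage (ζ z) (fun e => a e - θ e) e) ^ 2
    ≤ 4 * K ^ 2 * (Fintype.card S + t)) ∧
  (∀ z, -2 * ∑ e, (θ e - blockAverage (ζ z) θ e) * (a e - θ e)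
    ≤ (∑ e, (θ e - blockAverage (ζ z) θ e) ^ 2) / 2 + 4 * K ^ 2 * t) ∧
  ∀ z, 2 * ∑ e, (θ e - η z e) * (a e - θ e)
    ≤ (∑ e, (θ e - η z e) ^ 2) / 2 + 4 * K ^ 2 * t

lemma measurableSet_noiseBounded [Countable Z] (ζ : Z → E → S) (η : Z → E → ℝ) (K t : ℝ) (a : E → ℝ) :
    MeasurableSet {θ | NoiseBounded ζ η K t θ a} := by
  have hb := fun z e => measurable_blockAverage (ζ z) e
  have hb' : ∀ z e, Measurable fun θ : E → ℝ => blockAverage (ζ z) (fun e => a e - θ e) e :=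
    fun z e => (hb z e).comp (by fun_prop)
  simp only [NoiseBounded, measurableSet_setOfPred]
  refine .and (.forall fun z => ?_) (.and (.forall fun z => ?_) (.forall fun z => ?_))
  · exact Measurable.le' (by fun_prop) (by fun_prop)
  · exact Measurable.le' (by fun_prop) (by fun_prop)
  · exact Measurable.le' (by fun_prop) (by fun_prop)

/-- The error of least squares on the event that the noise is under control. -/
lemma NoiseBounded.sum_sq_sub_le {ζ : Z → E → S} {η : Z → E → ℝ} {K t : ℝ} {θ a : E → ℝ}
    (h : NoiseBounded ζ η K t θ a) {z z' : Z}
    (hmin : ∑ e, (a e - blockAverage (ζ z) a e) ^ 2 ≤ ∑ e, (a e - η z' e) ^ 2) :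
    ∑ e, (blockAverage (ζ z) a e - θ e) ^ 2 ≤ 3 * ∑ e, (θ e - η z' e) ^ 2
      + 4 * K ^ 2 * (3 * Fintype.card S + 7 * t) := by
  have h1 := bias_le_of_sum_sq_le (ζ z) a θ (η z') hmin
  have h2 := sum_sq_blockAverage_sub (ζ z) a θ
  have h3 := h.1 z
  have h4 := h.2.1 z
  have h5 := h.2.2 z'
  rw [h2]
  -- Half of the bias on the right of `h1` is absorbed on the left, doubling the remaining terms:
  -- the bias is at most `3 ∑ (θ - η) ^ 2 + 8 K ^ 2 (card S + 3 t)`. Adding the variance `4 K ^ 2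
  -- (card S + t)` gives the factors `3` and `7`.
  nlinarith

end Noise

/-! ### Tail bounds uniform over the labellings -/

section Chain

variable {N : ℕ} {p : (Fin N → Bool) → ℝ}

lemma pathProb_le_of_sum_mul_exp_le (hp : ∀ b, 0 ≤ p b) {X : Set (Fin N → Bool)}
    {Y : (Fin N → Bool) → ℝ} {t m : ℝ} (hX : ∀ b ∈ X, t ≤ Y b)
    (hm : ∑ b, p b * Real.exp (Y b) ≤ m) : pathProb p X ≤ m * Real.exp (-t) := by
  rw [Real.exp_neg, ← div_eq_mul_inv, le_div_iff₀ (Real.exp_pos t)]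
  refine le_trans ?_ hm
  rw [pathProb, Finset.sum_mul]
  refine Finset.sum_le_sum fun b _ => ?_
  by_cases hb : b ∈ X
  · rw [Set.indicator_of_mem hb]
    exact mul_le_mul_of_nonneg_left (Real.exp_le_exp.2 (hX b hb)) (hp b)
  · rw [Set.indicator_of_notMem hb, zero_mul]
    exact mul_nonneg (hp b) (Real.exp_pos _).le

lemma pathProb_union_le (hp : ∀ b, 0 ≤ p b) (X Y : Set (Fin N → Bool)) :
    pathProb p (X ∪ Y) ≤ pathProb p X + pathProb p Y := by
  rw [pathProb, pathProb, pathProb, ← Finset.sum_add_distrib]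
  refine Finset.sum_le_sum fun b _ => ?_
  have := hp b
  by_cases h1 : b ∈ X <;> by_cases h2 : b ∈ Y <;> simp [h1, h2, this]

lemma pathProb_exists_le {Z : Type*} [Fintype Z] (hp : ∀ b, 0 ≤ p b)
    (X : Z → Set (Fin N → Bool)) {m : ℝ} (hX : ∀ z, pathProb p (X z) ≤ m) :
    pathProb p {b | ∃ z, b ∈ X z} ≤ Fintype.card Z * m := by
  calc pathProb p {b | ∃ z, b ∈ X z} ≤ ∑ z, pathProb p (X z) := by
        simp only [pathProb]
        rw [Finset.sum_comm]
        refine Finset.sum_le_sum fun b _ => ?_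
        by_cases hb : ∃ z, b ∈ X z
        · obtain ⟨z, hz⟩ := hb
          rw [Set.indicator_of_mem (show b ∈ {b | ∃ z, b ∈ X z} from ⟨z, hz⟩)]
          have := Finset.single_le_sum (f := fun z => (X z).indicator p b)
            (fun z _ => Set.indicator_nonneg (fun b _ => hp b) b) (Finset.mem_univ z)
          simpa [hz] using this
        · rw [Set.indicator_of_notMem (show b ∉ {b | ∃ z, b ∈ X z} from hb)]
          exact Finset.sum_nonneg fun z _ => Set.indicator_nonneg (fun b _ => hp b) b
    _ ≤ ∑ _z : Z, m := Finset.sum_le_sum fun z _ => hX z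
    _ = _ := by simp

variable {E S : Type*} [Fintype E] [Fintype S] {Z : Type*} [Fintype Z] [DecidableEq S]

/-- Chernoff's bound for each of the three families of events, then a union over `Z`. The linear
thresholds include a share of the squared norm, so no bound on the norm of the direction is needed.
-/
lemma pathProb_not_noiseBounded_le (hp : ∀ b, 0 ≤ p b) {a : (Fin N → Bool) → E → ℝ} {θ : E → ℝ}
    {K : ℝ} (hK : 0 < K)
    (hε : ∀ w : E → ℝ, ∑ b, p b * Real.exp (∑ e, w e * (a b e - θ e))
      ≤ Real.exp (K ^ 2 * (∑ e, w e ^ 2) / 2))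
    (ζ : Z → E → S) (η : Z → E → ℝ) (t : ℝ) :
    pathProb p {b | ¬ NoiseBounded ζ η K t θ (a b)} ≤ 3 * Fintype.card Z * Real.exp (-t) := by
  have hlin : ∀ v : E → ℝ, pathProb p {b | (∑ e, v e ^ 2) / 2 + 4 * K ^ 2 * t
      < 2 * ∑ e, v e * (a b e - θ e)} ≤ Real.exp (-t) := by
    intro v
    -- This tilt makes the log-moment bound equal `∑ v ^ 2 / (8 K ^ 2)`, exactly the part of the
    -- threshold due to the squared norm; only `exp (-t)` survives.
    have h1 := hε fun e => (2 * K ^ 2)⁻¹ * v e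
    have h2 := pathProb_le_of_sum_mul_exp_le hp (X := {b | (∑ e, v e ^ 2) / 2 + 4 * K ^ 2 * t
      < 2 * ∑ e, v e * (a b e - θ e)}) (t := (∑ e, v e ^ 2) / (8 * K ^ 2) + t) (fun b hb => ?_) h1
    · refine h2.trans_eq ?_
      rw [← Real.exp_add]
      congr 1
      simp_rw [mul_pow, ← Finset.mul_sum]
      field_simp
      ring
    · have hb' : (∑ e, v e ^ 2) / 2 + 4 * K ^ 2 * t < 2 * ∑ e, v e * (a b e - θ e) := hb
      simp_rw [mul_assoc, ← Finset.mul_sum]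
      rw [← div_eq_inv_mul, le_div_iff₀ (by positivity)]
      have : ((∑ e, v e ^ 2) / (8 * K ^ 2) + t) * (2 * K ^ 2)
          = (∑ e, v e ^ 2) / 4 + 2 * K ^ 2 * t := by
        field_simp
        ring
      rw [this]
      linarith
  have hquad : ∀ c : E → S, pathProb p {b | 4 * K ^ 2 * (Fintype.card S + t)
      < ∑ e, (blockAverage c (fun e => a b e - θ e) e) ^ 2} ≤ Real.exp (-t) := by
    intro c
    have h1 := sum_mul_exp_sum_sq_le hK hε (blockIndicator c) (sum_sq_sum_blockIndicator_le c)
    have h2 := pathProb_le_of_sum_mul_exp_le hp (X := {b | 4 * K ^ 2 * (Fintype.card S + t)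
      < ∑ e, (blockAverage c (fun e => a b e - θ e) e) ^ 2}) (t := Fintype.card S + t)
      (fun b hb => ?_) h1
    · refine h2.trans ?_
      rw [neg_add, Real.exp_add, ← mul_assoc]
      -- The `card S` in the threshold pays for the moment bound, because `√2 ≤ exp 1`.
      refine mul_le_of_le_one_left (Real.exp_pos _).le ?_
      rw [Real.exp_neg, mul_inv_le_iff₀ (Real.exp_pos _), one_mul, ← mul_one (Fintype.card S : ℝ),
        Real.exp_nat_mul]
      refine pow_le_pow_left₀ (by positivity) ?_ _
      rw [Real.sqrt_le_left (Real.exp_pos 1).le]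
      nlinarith [Real.add_one_le_exp (1 : ℝ)]
    · have hb' : 4 * K ^ 2 * (Fintype.card S + t)
        < ∑ e, (blockAverage c (fun e => a b e - θ e) e) ^ 2 := hb
      rw [sum_sq_blockAverage] at hb'
      rw [le_div_iff₀ (by positivity)]
      linarith
  have hsub : {b | ¬ NoiseBounded ζ η K t θ (a b)} ⊆
      ({b | ∃ z, b ∈ {b | 4 * K ^ 2 * (Fintype.card S + t)
          < ∑ e, (blockAverage (ζ z) (fun e => a b e - θ e) e) ^ 2}} ∪
        {b | ∃ z, b ∈ {b | (∑ e, (-(θ e - blockAverage (ζ z) θ e)) ^ 2) / 2 + 4 * K ^ 2 * t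
          < 2 * ∑ e, -(θ e - blockAverage (ζ z) θ e) * (a b e - θ e)}}) ∪
        {b | ∃ z, b ∈ {b | (∑ e, (θ e - η z e) ^ 2) / 2 + 4 * K ^ 2 * t
          < 2 * ∑ e, (θ e - η z e) * (a b e - θ e)}} := by
    intro b hb
    by_contra hcon
    simp only [Set.mem_union, Set.mem_ofPred_eq, not_or, not_exists, not_lt, neg_sq, neg_mul,
      Finset.sum_neg_distrib, mul_neg] at hcon
    refine hb ⟨hcon.1.1, fun z => ?_, hcon.2⟩
    have := hcon.1.2 z
    linarith
  refine (pathProb_mono hp hsub).trans ((pathProb_union_le hp _ _).trans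
    ((add_le_add_left (pathProb_union_le hp _ _) _).trans ?_))
  have q1 := pathProb_exists_le hp _ fun z => hquad (ζ z)
  have q2 := pathProb_exists_le hp _ fun z => hlin fun e => -(θ e - blockAverage (ζ z) θ e)
  have q3 := pathProb_exists_le hp _ fun z => hlin fun e => θ e - η z e
  linarith

end Chain

/-! ### The conditional law of the edge sequence given the latent variables -/

section Conditional

variable {Ω : Type*} {n N : ℕ} {ξ : Fin n → Ω → I} {B : Fin N → Ω → Bool}

lemma latentSigma_eq_comap (ξ : Fin n → Ω → I) :
    latentSigma ξ = MeasurableSpace.comap (fun ω i => ξ i ω) MeasurableSpace.pi := by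
  unfold latentSigma MeasurableSpace.pi
  rw [MeasurableSpace.comap_iSup]
  simp_rw [MeasurableSpace.comap_comp]
  rfl

lemma historySigma_eq_comap (ξ : Fin n → Ω → I) (B : Fin N → Ω → Bool) (S : Set (Fin N)) :
    historySigma ξ B S = MeasurableSpace.comap
      (fun ω => ((fun i => ξ i ω : Fin n → I), (fun t => B t ω : S → Bool))) inferInstance := by
  have := MeasurableSpace.comap_prodMk (mβ := MeasurableSpace.pi) (mγ := MeasurableSpace.pi)
    (fun ω i => ξ i ω : Ω → Fin n → I) (fun ω t => B t ω : Ω → S → Bool)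
  unfold historySigma
  rw [latentSigma_eq_comap]
  refine Eq.trans ?_ this.symm
  congr 1
  unfold MeasurableSpace.pi
  rw [MeasurableSpace.comap_iSup, iSup_subtype']
  simp_rw [MeasurableSpace.comap_comp]
  rfl

/-- The path of the sequence `B`. -/
def pathOf (B : Fin N → Ω → Bool) (ω : Ω) : Fin N → Bool := fun t => B t ω

lemma measurableSet_historySigma_preimage {S : Set (Fin N)} (b : Fin N → Bool) :
    MeasurableSet[historySigma ξ B S] (pathOf B ⁻¹' agreeOn S b) := by
  have : pathOf B ⁻¹' agreeOn S b = ⋂ t ∈ S, B t ⁻¹' {b t} := by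
    ext ω; simp [agreeOn, pathOf]
  rw [this]
  refine MeasurableSet.biInter S.to_countable fun t ht => ?_
  have hle : MeasurableSpace.comap (B t) inferInstance ≤ historySigma ξ B S :=
    le_sup_of_le_right (le_iSup₂_of_le t ht le_rfl)
  exact hle _ ⟨{b t}, measurableSet_singleton _, rfl⟩

/-- On the event that the sequence agrees with `b` on `S`, functions of `ξ` and of the values on
`S` are functions of `ξ`. -/
lemma exists_measurable_eq_on_agreeOn {S : Set (Fin N)} {h : Ω → ℝ}
    (hh : StronglyMeasurable[historySigma ξ B S] h) (b : Fin N → Bool) :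
    ∃ h' : Ω → ℝ, StronglyMeasurable[latentSigma ξ] h' ∧
      ∀ ω, pathOf B ω ∈ agreeOn S b → h ω = h' ω := by
  rw [historySigma_eq_comap] at hh
  obtain ⟨φ, hφ, rfl⟩ := hh.exists_eq_measurable_comp
  refine ⟨fun ω => φ ((fun i => ξ i ω), fun t => b t), ?_, fun ω hω => ?_⟩
  · rw [latentSigma_eq_comap]
    refine Measurable.stronglyMeasurable ?_
    refine Measurable.comp (g := fun x : Fin n → I => φ (x, fun t => b t)) ?_
      (comap_measurable _)
    exact hφ.measurable.comp (by fun_prop)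
  · simp only [Function.comp_apply]
    congr 2
    ext t
    exact hω t t.2

variable [mΩ : MeasurableSpace Ω] {P : Measure Ω}

lemma latentSigma_le (hξ : ∀ i, Measurable (ξ i)) : latentSigma ξ ≤ mΩ :=
  iSup_le fun i => (hξ i).comap_le

lemma historySigma_le (hξ : ∀ i, Measurable (ξ i)) (hB : ∀ t, Measurable (B t))
    (S : Set (Fin N)) : historySigma ξ B S ≤ mΩ :=
  sup_le (latentSigma_le hξ) (iSup₂_le fun t _ => (hB t).comap_le)

lemma measurable_pathOf (hB : ∀ t, Measurable (B t)) : Measurable (pathOf B) :=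
  measurable_pi_lambda _ hB

/-- The conditional probability mass function of the path of `B` given `ξ`. -/
noncomputable def condPathProb (P : Measure Ω) (ξ : Fin n → Ω → I) (B : Fin N → Ω → Bool)
    (ω : Ω) (b : Fin N → Bool) : ℝ :=
  (P⟦pathOf B ⁻¹' {b} | latentSigma ξ⟧) ω

lemma measurableSet_pathOf_preimage (hB : ∀ t, Measurable (B t)) (X : Set (Fin N → Bool)) :
    MeasurableSet (pathOf B ⁻¹' X) :=
  measurable_pathOf hB (Set.toFinite X).measurableSet

lemma measurable_condPathProb (b : Fin N → Bool) :
    Measurable[latentSigma ξ] fun ω => condPathProb P ξ B ω b :=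
  stronglyMeasurable_condExp.measurable

lemma measurable_pathProb_condPathProb (X : Set (Fin N → Bool)) :
    Measurable[latentSigma ξ] fun ω => pathProb (condPathProb P ξ B ω) X := by
  unfold pathProb
  refine Finset.measurable_sum _ fun b _ => ?_
  by_cases hb : b ∈ X
  · simpa only [Set.indicator_of_mem hb] using measurable_condPathProb b
  · simpa only [Set.indicator_of_notMem hb] using measurable_const

lemma ae_condPathProb_nonneg : ∀ᵐ ω ∂P, ∀ b, 0 ≤ condPathProb P ξ B ω b := by
  rw [ae_all_iff]
  intro b
  exact condExp_nonneg (Filter.Eventually.of_forall fun ω => Set.indicator_nonneg (by simp) ω)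

variable [IsProbabilityMeasure P]

lemma condExp_preimage_eq_pathProb (hB : ∀ t, Measurable (B t)) (X : Set (Fin N → Bool)) :
    P⟦pathOf B ⁻¹' X | latentSigma ξ⟧ =ᵐ[P] fun ω => pathProb (condPathProb P ξ B ω) X := by
  classical
  have e : (pathOf B ⁻¹' X).indicator (fun _ => (1 : ℝ))
      = ∑ b ∈ Finset.univ.filter (· ∈ X), (pathOf B ⁻¹' {b}).indicator fun _ => (1 : ℝ) := by
    ext ω
    rw [Finset.sum_apply]
    by_cases hω : pathOf B ω ∈ X
    · rw [Set.indicator_of_mem (show ω ∈ pathOf B ⁻¹' X from hω),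
        Finset.sum_eq_single (pathOf B ω)]
      · simp
      · intro b _ hb
        exact Set.indicator_of_notMem (s := pathOf B ⁻¹' {b}) (fun h => hb (Eq.symm h)) _
      · simp [hω]
    · rw [Set.indicator_of_notMem (show ω ∉ pathOf B ⁻¹' X from hω)]
      symm
      refine Finset.sum_eq_zero fun b hb => Set.indicator_of_notMem (s := pathOf B ⁻¹' {b}) (fun h => hω ?_) _
      have : pathOf B ω = b := h
      rw [this]; simpa using hb
  rw [e]
  refine (condExp_finsetSum (fun b _ =>
    (integrable_const (1 : ℝ)).indicator (measurableSet_pathOf_preimage hB {b})) _).trans ?_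
  refine Filter.Eventually.of_forall fun ω => ?_
  simp only [Finset.sum_apply, Finset.sum_filter, pathProb]
  refine Finset.sum_congr rfl fun b _ => ?_
  by_cases hb : b ∈ X <;> simp [hb, condPathProb]

lemma ae_sum_condPathProb (hξ : ∀ i, Measurable (ξ i)) (hB : ∀ t, Measurable (B t)) :
    ∀ᵐ ω ∂P, ∑ b, condPathProb P ξ B ω b = 1 := by
  have := condExp_preimage_eq_pathProb (P := P) (ξ := ξ) hB Set.univ
  filter_upwards [this] with ω hω
  simp only [Set.preimage_univ, Set.indicator_univ, pathProb] at hω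
  rw [← hω, condExp_const (latentSigma_le hξ)]

/-- Bayes' formula for the conditional probability given `ξ` and the values on `S`. -/
lemma ae_condExp_historySigma_mul (hξ : ∀ i, Measurable (ξ i)) (hB : ∀ t, Measurable (B t))
    (S : Set (Fin N)) (X : Set (Fin N → Bool)) (b : Fin N → Bool) :
    ∀ᵐ ω ∂P, pathOf B ω ∈ agreeOn S b →
      (P⟦pathOf B ⁻¹' X | historySigma ξ B S⟧) ω * pathProb (condPathProb P ξ B ω) (agreeOn S b)
        = pathProb (condPathProb P ξ B ω) (X ∩ agreeOn S b) := by
  set C := pathOf B ⁻¹' agreeOn S b with hC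
  set h := P⟦pathOf B ⁻¹' X | historySigma ξ B S⟧ with hh
  have hCm : MeasurableSet C := measurableSet_pathOf_preimage hB _
  have hXm : MeasurableSet (pathOf B ⁻¹' X) := measurableSet_pathOf_preimage hB _
  obtain ⟨h', hh'm, hh'⟩ := exists_measurable_eq_on_agreeOn (ξ := ξ) (B := B) (S := S) (h := h)
    stronglyMeasurable_condExp b
  -- On `C` the values at the times in `S` are frozen, so `h` agrees with a function of `ξ` alone,
  -- which can be taken out of the conditional expectation given `ξ`.
  have hmul : C.indicator h = h' * C.indicator fun _ => (1 : ℝ) := by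
    ext ω
    by_cases hω : ω ∈ C
    · simp [hω, hh' ω hω]
    · simp [hω]
  have hint : Integrable (h' * C.indicator fun _ => (1 : ℝ)) P := by
    rw [← hmul]
    exact integrable_condExp.indicator hCm
  have h1 : P⟦pathOf B ⁻¹' (X ∩ agreeOn S b) | historySigma ξ B S⟧ =ᵐ[P] C.indicator h := by
    have e : (pathOf B ⁻¹' (X ∩ agreeOn S b)).indicator (fun _ => (1 : ℝ))
        = C.indicator ((pathOf B ⁻¹' X).indicator fun _ => (1 : ℝ)) := by
      rw [Set.indicator_indicator, Set.preimage_inter, Set.inter_comm]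
    rw [e]
    exact condExp_indicator ((integrable_const (1 : ℝ)).indicator hXm)
      (measurableSet_historySigma_preimage b)
  have h2 : P⟦pathOf B ⁻¹' (X ∩ agreeOn S b) | latentSigma ξ⟧
      =ᵐ[P] h' * P⟦C | latentSigma ξ⟧ := by
    have t1 := condExp_condExp_of_le (μ := P)
      (f := (pathOf B ⁻¹' (X ∩ agreeOn S b)).indicator fun _ => (1 : ℝ))
      (le_sup_left : latentSigma ξ ≤ historySigma ξ B S) (historySigma_le hξ hB S)
    refine t1.symm.trans ((condExp_congr_ae h1).trans ?_)
    rw [hmul]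
    exact condExp_mul_of_stronglyMeasurable_left hh'm hint
      ((integrable_const (1 : ℝ)).indicator hCm)
  filter_upwards [h2, condExp_preimage_eq_pathProb (P := P) (ξ := ξ) hB (X ∩ agreeOn S b),
    condExp_preimage_eq_pathProb (P := P) (ξ := ξ) hB (agreeOn S b)] with ω w2 w3 w4 hω
  rw [← w3, ← w4, w2, hh' ω hω]
  rfl

/-- An event determined by `ξ` which holds on the event that the path lies in `X` holds wherever the
conditional probability of the latter is not zero. -/
lemma ae_pathProb_eq_zero_or (hB : ∀ t, Measurable (B t))
    {X : Set (Fin N → Bool)} {A : Set Ω} (hA : MeasurableSet[latentSigma ξ] A)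
    (h : ∀ᵐ ω ∂P, pathOf B ω ∈ X → ω ∈ A) :
    ∀ᵐ ω ∂P, pathProb (condPathProb P ξ B ω) X = 0 ∨ ω ∈ A := by
  have h0 : Aᶜ.indicator ((pathOf B ⁻¹' X).indicator fun _ => (1 : ℝ)) =ᵐ[P] 0 := by
    filter_upwards [h] with ω hω
    by_cases h1 : ω ∈ A
    · simp [h1]
    · have h2 : pathOf B ω ∉ X := fun hx => h1 (hω hx)
      simp [h2]
  have h1 := condExp_indicator (μ := P) (m := latentSigma ξ)
    ((integrable_const (1 : ℝ)).indicator (measurableSet_pathOf_preimage hB X)) hA.compl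
  have h2 := (condExp_congr_ae (m := latentSigma ξ) h0).symm.trans h1
  rw [condExp_zero] at h2
  filter_upwards [h2, condExp_preimage_eq_pathProb (P := P) (ξ := ξ) hB X] with ω w2 w3
  by_cases hω : ω ∈ A
  · exact .inr hω
  · left
    rw [Set.indicator_of_mem (by simpa using hω)] at w2
    rw [← w3, ← w2]
    rfl

/-- Disintegration of a probability along `ξ`. -/
lemma measureReal_path_mem_le (hξ : ∀ i, Measurable (ξ i)) (hB : ∀ t, Measurable (B t))
    {D : (Fin N → Bool) → Set Ω} (hD : ∀ b, MeasurableSet[latentSigma ξ] (D b)) {r : ℝ}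
    (h : ∀ᵐ ω ∂P, pathProb (condPathProb P ξ B ω) {b | ω ∈ D b} ≤ r) :
    P.real {ω | ω ∈ D (pathOf B ω)} ≤ r := by
  have hle := latentSigma_le hξ
  have hunion : {ω | ω ∈ D (pathOf B ω)} = ⋃ b, (pathOf B ⁻¹' {b} ∩ D b) := by
    ext ω
    simp
  have h1 : ∀ b, P.real (pathOf B ⁻¹' {b} ∩ D b)
      = ∫ ω, (D b).indicator (fun ω => condPathProb P ξ B ω b) ω ∂P := by
    intro b
    rw [integral_indicator (hle _ (hD b))]
    unfold condPathProb
    rw [setIntegral_condExp hle ((integrable_const (1 : ℝ)).indicator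
      (measurableSet_pathOf_preimage hB {b})) (hD b),
      integral_indicator (measurableSet_pathOf_preimage hB {b}), setIntegral_const, smul_eq_mul,
      mul_one, measureReal_restrict_apply (measurableSet_pathOf_preimage hB {b})]
  have hint : ∀ b, Integrable ((D b).indicator fun ω => condPathProb P ξ B ω b) P := fun b =>
    integrable_condExp.indicator (hle _ (hD b))
  rw [hunion]
  calc P.real (⋃ b, (pathOf B ⁻¹' {b} ∩ D b)) ≤ ∑ b, P.real (pathOf B ⁻¹' {b} ∩ D b) :=
        measureReal_iUnion_fintype_le _
    _ = ∫ ω, ∑ b, (D b).indicator (fun ω => condPathProb P ξ B ω b) ω ∂P := by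
        rw [integral_finsetSum _ fun b _ => hint b]
        exact Finset.sum_congr rfl fun b _ => h1 b
    _ ≤ ∫ _ω, r ∂P := by
        refine integral_mono_ae (integrable_finsetSum _ fun b _ => hint b) (integrable_const r) ?_
        filter_upwards [h] with ω hω
        refine le_trans (le_of_eq ?_) hω
        rw [pathProb]
        refine Finset.sum_congr rfl fun b _ => ?_
        by_cases hb : ω ∈ D b <;> simp [hb]
    _ = r := by simp

end Conditional

/-- At time `0` the all-`true` and all-`false` blocks are disjoint events, each of conditional
probability at least `α'`. With `l = 0` both blocks would be empty and the argument fails. -/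
lemma IsMemoryChain.le_half {N : ℕ} {p : (Fin N → Bool) → ℝ} {l : ℕ} {α' : ℝ}
    (h : IsMemoryChain p l) (hl : 1 ≤ l) (hN : 0 < N) (hb : BlockLowerBound p l α') :
    α' ≤ 1 / 2 := by
  obtain ⟨v, hv⟩ := h.exists_pos
  set s : Fin N := ⟨0, hN⟩
  set C := agreeOn {t : Fin N | (t : ℕ) + l ≤ s ∧ (s : ℕ) < t + 2 * l} v
  set T : Set (Fin N) := {t | t ≤ s ∧ (s : ℕ) < t + l}
  have hs : s ∈ T := ⟨le_rfl, by omega⟩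
  have h1 := hb s (fun _ => true) v
  have h2 := hb s (fun _ => false) v
  have hc : 0 < pathProb p C := hv.trans_le (le_pathProb h.nonneg (self_mem_agreeOn _ _))
  have hadd : pathProb p (agreeOn T (fun _ => true) ∩ C) + pathProb p (agreeOn T (fun _ => false) ∩ C)
      ≤ pathProb p C := by
    simp only [pathProb]
    rw [← Finset.sum_add_distrib]
    refine Finset.sum_le_sum fun b _ => ?_
    have hp := h.nonneg b
    by_cases h1 : b ∈ agreeOn T (fun _ => true) ∩ C
    · have h2 : b ∉ agreeOn T (fun _ => false) ∩ C := fun h2 => by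
        have e1 := h1.1 s hs
        have e2 := h2.1 s hs
        simp [e1] at e2
      rw [Set.indicator_of_mem h1, Set.indicator_of_notMem h2, Set.indicator_of_mem h1.2, add_zero]
    · rw [Set.indicator_of_notMem h1, zero_add]
      exact Set.indicator_le_indicator_of_subset Set.inter_subset_right (fun b => h.nonneg b) b
  have h3 : (2 * α') * pathProb p C ≤ 1 * pathProb p C := by linarith
  have := le_of_mul_le_mul_right h3 hc
  linarith

/-- The connection probability of an unordered pair of nodes. -/
def connectionValue {n : ℕ} (f : I → I → ℝ) (hf : ∀ x y, f x y = f y x) (x : Fin n → I)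
    (e : Sym2 (Fin n)) : ℝ :=
  Sym2.lift ⟨fun i j => f (x i) (x j), fun _ _ => hf _ _⟩ e

/-! ### The conditional edge law as a mixing chain -/

section Model

variable {Ω : Type*} [mΩ : MeasurableSpace Ω] {P : Measure Ω} {n : ℕ}
  {ξ : Fin n → Ω → I} {A : Sym2 (Fin n) → Ω → Bool} {ord : NodePair n ≃ Fin (n.choose 2)}
  {l : ℕ} {α' : ℝ} {f : I → I → ℝ}

namespace IsCompositeGraphonModel

lemma measurable_orderedEdge (h : IsCompositeGraphonModel P ξ A ord l α' f)
    (s : Fin (n.choose 2)) : Measurable (orderedEdge A ord s) :=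
  h.measurable_edge _

variable [IsProbabilityMeasure P]

/-- Bayes' formula turns the two conditional expectations in the Markov property into quotients of
`condPathProb`. The resulting identity is an event of `ξ`, so it need only hold where the path
realizes the given past; for a past of conditional probability zero it is trivial. -/
lemma ae_isMemoryChain (h : IsCompositeGraphonModel P ξ A ord l α' f) :
    ∀ᵐ ω ∂P, IsMemoryChain (condPathProb P ξ (orderedEdge A ord) ω) l := by
  have hξ := h.measurable_latent
  have hB := h.measurable_orderedEdge
  set B := orderedEdge A ord
  have hmk : ∀ᵐ ω ∂P, ∀ (s : Fin (n.choose 2)) (b : Fin (n.choose 2) → Bool),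
      pathProb (condPathProb P ξ B ω) (agreeOn {t | t < s} b) = 0 ∨
      pathProb (condPathProb P ξ B ω) (agreeOn {t | t < s} b) *
        pathProb (condPathProb P ξ B ω)
          (agreeOn {t | t < s ∧ (s : ℕ) ≤ t + l} b ∩ {x | x s = true})
      = pathProb (condPathProb P ξ B ω) (agreeOn {t | t < s} b ∩ {x | x s = true}) *
        pathProb (condPathProb P ξ B ω) (agreeOn {t | t < s ∧ (s : ℕ) ≤ t + l} b) := by
    rw [ae_all_iff]; intro s
    rw [ae_all_iff]; intro b
    refine ae_pathProb_eq_zero_or (A := {ω | _ = _}) hB (measurableSet_eq_fun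
      ((measurable_pathProb_condPathProb _).mul (measurable_pathProb_condPathProb _))
      ((measurable_pathProb_condPathProb _).mul (measurable_pathProb_condPathProb _))) ?_
    filter_upwards [ae_condExp_historySigma_mul (P := P) hξ hB {t | t < s} {x | x s = true} b,
      ae_condExp_historySigma_mul (P := P) hξ hB {t | t < s ∧ (s : ℕ) ≤ t + l} {x | x s = true} b,
      h.markov s] with ω w1 w2 w3 hω
    have e1 := w1 hω
    have e2 := w2 fun t ht => hω t ht.1
    have w3' : (P⟦pathOf B ⁻¹' {x | x s = true} | historySigma ξ B {t | t < s}⟧) ω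
      = (P⟦pathOf B ⁻¹' {x | x s = true} |
        historySigma ξ B {t | t < s ∧ (s : ℕ) ≤ t + l}⟧) ω := w3
    rw [w3'] at e1
    rw [Set.inter_comm] at e1 e2
    change _ = _
    rw [← e1, ← e2]
    ring
  filter_upwards [ae_condPathProb_nonneg (P := P) (ξ := ξ) (B := B), ae_sum_condPathProb hξ hB, hmk]
    with ω w1 w2 w3
  refine ⟨w1, w2, fun s b => ?_⟩
  rcases w3 s b with h0 | h0
  · have h1 := pathProb_mono w1 (Set.inter_subset_left (s := agreeOn {t | t < s} b)
      (t := {x | x s = true}))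
    rw [h0] at h1 ⊢
    rw [le_antisymm h1 (pathProb_nonneg w1 _)]
    ring
  · exact h0

lemma ae_blockLowerBound (h : IsCompositeGraphonModel P ξ A ord l α' f) :
    ∀ᵐ ω ∂P, BlockLowerBound (condPathProb P ξ (orderedEdge A ord) ω) l α' := by
  have hξ := h.measurable_latent
  have hB := h.measurable_orderedEdge
  have htr := h.transition_ge
  set B := orderedEdge A ord
  have hmk : ∀ᵐ ω ∂P, ∀ (s : Fin (n.choose 2)) (u v : Fin (n.choose 2) → Bool),
      pathProb (condPathProb P ξ B ω)
        (agreeOn {t | (t : ℕ) + l ≤ s ∧ (s : ℕ) < t + 2 * l} v) = 0 ∨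
      α' * pathProb (condPathProb P ξ B ω)
          (agreeOn {t | (t : ℕ) + l ≤ s ∧ (s : ℕ) < t + 2 * l} v)
        ≤ pathProb (condPathProb P ξ B ω) (agreeOn {t | t ≤ s ∧ (s : ℕ) < t + l} u ∩
          agreeOn {t | (t : ℕ) + l ≤ s ∧ (s : ℕ) < t + 2 * l} v) := by
    rw [ae_all_iff]; intro s
    rw [ae_all_iff]; intro u
    rw [ae_all_iff]; intro v
    refine ae_pathProb_eq_zero_or (A := {ω | _ ≤ _}) hB (measurableSet_le
      ((measurable_pathProb_condPathProb _).const_mul _) (measurable_pathProb_condPathProb _)) ?_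
    filter_upwards [ae_condExp_historySigma_mul (P := P) hξ hB
      {t | (t : ℕ) + l ≤ s ∧ (s : ℕ) < t + 2 * l} (agreeOn {t | t ≤ s ∧ (s : ℕ) < t + l} u) v,
      htr s u, ae_condPathProb_nonneg (P := P) (ξ := ξ) (B := B)] with ω w1 w2 w3 hω
    have e1 := w1 hω
    have e2 : {ω' | ∀ t : Fin (n.choose 2), t ≤ s → (s : ℕ) < t + l → B t ω' = u t}
        = pathOf B ⁻¹' agreeOn {t | t ≤ s ∧ (s : ℕ) < t + l} u := by
      ext ω'
      exact forall_congr' fun t => and_imp.symm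
    rw [e2] at w2
    rw [← e1]
    exact mul_le_mul_of_nonneg_right w2 (pathProb_nonneg w3 _)
  filter_upwards [ae_condPathProb_nonneg (P := P) (ξ := ξ) (B := B), hmk] with ω w1 w2 s u v
  rcases w2 s u v with h0 | h0
  · rw [h0, mul_zero]
    exact pathProb_nonneg w1 _
  · exact h0

lemma ae_sum_mul_pathValue (h : IsCompositeGraphonModel P ξ A ord l α' f)
    (hf : ∀ x y, f x y = f y x) :
    ∀ᵐ ω ∂P, ∀ t, ∑ b, condPathProb P ξ (orderedEdge A ord) ω b * pathValue t b
      = connectionValue f hf (fun i => ξ i ω) (ord.symm t).1 := by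
  have hB := h.measurable_orderedEdge
  set B := orderedEdge A ord with hBdef
  rw [ae_all_iff]
  intro t
  obtain ⟨i, j, hij⟩ : ∃ i j, (ord.symm t).1 = s(i, j) := by
    induction (ord.symm t).1 with | _ i j => exact ⟨i, j, rfl⟩
  have hne : i ≠ j := by
    have := (ord.symm t).2
    rw [hij] at this
    simpa using this
  filter_upwards [h.marginal i j hne,
    condExp_preimage_eq_pathProb (P := P) (ξ := ξ) hB {x | x t = true}] with ω w1 w2
  have e : pathOf B ⁻¹' {x | x t = true} = {ω | A s(i, j) ω = true} := by
    rw [← hij]; rfl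
  rw [e, w1] at w2
  rw [hij]
  refine Eq.trans ?_ w2.symm
  rw [pathProb_eq_sum_mul]
  refine Finset.sum_congr rfl fun b _ => ?_
  by_cases hb : b t = true <;> simp [pathValue, hb]

end IsCompositeGraphonModel

end Model

/-! ### Hölder graphons -/

/-- By symmetry of `f`, points in opposite triangles can be reflected into the same one. The
reflection does not increase the distance: `|x - y'| + |y - x'| ≤ |x - x'| + |y - y'|` when `y ≤ x`
and `x' ≤ y'`. -/
lemma abs_sub_le_of_mem_holderClass {α M : ℝ} (hα : 0 < α) (hM : 0 < M) {f : I → I → ℝ}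
    (hf : f ∈ holderClass α M) (x y x' y' : I) :
    |f x y - f x' y'| ≤ M * (|(x : ℝ) - x'| + |(y : ℝ) - y'|) ^ α := by
  obtain ⟨hs, h⟩ := hf
  have swap : ∀ x y x' y' : I, y ≤ x → x' ≤ y' →
      |f x y - f x' y'| ≤ M * (|(x : ℝ) - x'| + |(y : ℝ) - y'|) ^ α := by
    intro x y x' y' h1 h2
    rw [hs x' y']
    refine (h x y y' x' h1 h2).trans ?_
    have h1' : (y : ℝ) ≤ x := h1
    have h2' : (x' : ℝ) ≤ y' := h2
    gcongr ?_ * ?_ ^ _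
    rcases abs_cases ((x : ℝ) - x') with ⟨e1, _⟩ | ⟨e1, _⟩ <;>
    rcases abs_cases ((y : ℝ) - y') with ⟨e2, _⟩ | ⟨e2, _⟩ <;>
    rcases abs_cases ((x : ℝ) - y') with ⟨e3, _⟩ | ⟨e3, _⟩ <;>
    rcases abs_cases ((y : ℝ) - x') with ⟨e4, _⟩ | ⟨e4, _⟩ <;>
    rw [e1, e2, e3, e4] <;> linarith
  rcases le_total y x with h1 | h1 <;> rcases le_total y' x' with h2 | h2
  · exact h x y x' y' h1 h2
  · exact swap x y x' y' h1 h2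
  · have := swap x' y' x y h2 h1
    rwa [abs_sub_comm, abs_sub_comm (x' : ℝ), abs_sub_comm (y' : ℝ)] at this
  · have := h y x y' x' h1 h2
    rwa [hs y x, hs y' x', add_comm] at this

lemma continuous_of_mem_holderClass {α M : ℝ} (hα : 0 < α) (hM : 0 < M) {f : I → I → ℝ}
    (hf : f ∈ holderClass α M) : Continuous fun p : I × I => f p.1 p.2 := by
  rw [continuous_iff_continuousAt]
  rintro ⟨x, y⟩
  rw [ContinuousAt, tendsto_iff_dist_tendsto_zero]
  refine squeeze_zero (fun _ => dist_nonneg)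
    (fun p => abs_sub_le_of_mem_holderClass hα hM hf p.1 p.2 x y) ?_
  have hc : Continuous fun p : I × I =>
      M * (|(p.1 : ℝ) - x| + |(p.2 : ℝ) - y|) ^ α := by
    refine continuous_const.mul (Continuous.rpow_const ?_ fun _ => .inr hα.le)
    fun_prop
  have := hc.tendsto (x, y)
  simpa [Real.zero_rpow hα.ne'] using this

lemma measurable_connectionValue {n : ℕ} {f : I → I → ℝ} (hf : ∀ x y, f x y = f y x)
    (hc : Continuous fun p : I × I => f p.1 p.2) (e : Sym2 (Fin n)) :
    Measurable fun x : Fin n → I => connectionValue f hf x e := by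
  induction e with | _ i j =>
  simp only [connectionValue, Sym2.lift_mk]
  exact hc.measurable.comp (f := fun x : Fin n → I => (x i, x j)) (by fun_prop)

/-- The grid point `a / k` of the unit interval. -/
noncomputable def gridPoint {k : ℕ} (a : Fin k) : I :=
  ⟨(a : ℝ) / k, by positivity, by
    rw [div_le_one (by exact_mod_cast a.pos)]
    exact_mod_cast a.2.le⟩

lemma exists_abs_sub_gridPoint_le {k : ℕ} (hk : 1 ≤ k) (x : I) :
    ∃ a : Fin k, |(x : ℝ) - gridPoint a| ≤ 1 / k := by
  have hk' : (0 : ℝ) < k := by exact_mod_cast hk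
  obtain ⟨h0, h1⟩ := x.2
  have hkx : 0 ≤ (k : ℝ) * x := by positivity
  by_cases hlt : ⌊(k : ℝ) * x⌋₊ < k
  · refine ⟨⟨_, hlt⟩, ?_⟩
    have f1 := Nat.floor_le hkx
    have f2 := Nat.lt_floor_add_one ((k : ℝ) * x)
    simp only [gridPoint]
    have e : (x : ℝ) - (⌊(k : ℝ) * x⌋₊ : ℝ) / k = ((k : ℝ) * x - ⌊(k : ℝ) * x⌋₊) / k := by
      field_simp
    rw [e, abs_div, abs_of_pos hk', abs_of_nonneg (by linarith)]
    gcongr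
    linarith
  · have hge : (k : ℝ) ≤ k * x := by
      have : (k : ℝ) ≤ ⌊(k : ℝ) * x⌋₊ := by exact_mod_cast not_lt.1 hlt
      exact this.trans (Nat.floor_le hkx)
    -- The floor reaches `k` only at the right endpoint, which is assigned to the last grid point
    -- `(k - 1) / k`.
    have hx : (x : ℝ) = 1 := le_antisymm h1 (by nlinarith)
    refine ⟨⟨k - 1, by omega⟩, ?_⟩
    simp only [gridPoint, hx]
    rw [Nat.cast_sub hk, Nat.cast_one, sub_div, div_self hk'.ne', sub_sub_cancel,
      abs_of_pos (by positivity)]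

/-- Hölder graphons are approximated by their values on the grid. -/
lemma exists_abs_connectionValue_sub_le {α M : ℝ} (hα : 0 < α) (hM : 0 < M) {f : I → I → ℝ}
    (hf : f ∈ holderClass α M) {n k : ℕ} (hk : 1 ≤ k) (x : Fin n → I) :
    ∃ z : Fin n → Fin k, ∀ e : NodePair n,
      |connectionValue f hf.1 x e.1 - connectionValue f hf.1 gridPoint (pairLabel z e)|
        ≤ M * (2 / k) ^ α := by
  choose z hz using fun i => exists_abs_sub_gridPoint_le hk (x i)
  refine ⟨z, ?_⟩
  rintro ⟨e, he⟩
  induction e with | _ i j =>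
  simp only [pairLabel, connectionValue, Sym2.map_mk, Sym2.lift_mk]
  refine (abs_sub_le_of_mem_holderClass hα hM hf _ _ _ _).trans ?_
  have h1 := hz i
  have h2 := hz j
  have e2 : (2 : ℝ) / k = 1 / k + 1 / k := by ring
  rw [e2]
  gcongr

/-! ### Rates -/

/-- The constant in the rate of convergence. -/
noncomputable def rateConstant (α M : ℝ) (L : ℕ) (c₁ c₂ : ℝ) : ℝ :=
  6 * M ^ 2 * ((2 / c₁) ^ α) ^ 2 + 8 * (L + 1) ^ 2 * (6 * c₂ ^ 2 + 14 * Real.log (1 + c₂) + 35)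

lemma one_le_two_mul_log {n : ℕ} (hn : 2 ≤ n) : 1 ≤ 2 * Real.log n := by
  have h1 : Real.log 2 ≤ Real.log n := Real.log_le_log (by norm_num) (by exact_mod_cast hn)
  linarith [Real.log_two_gt_d9]

lemma inv_le_rpow_rate {α : ℝ} (hα : 0 < α) (hα1 : α ≤ 1) {n : ℕ} (hn : 1 ≤ n) :
    (n : ℝ)⁻¹ ≤ (n : ℝ) ^ (-2 * α / (1 + α)) := by
  rw [← Real.rpow_neg_one]
  refine Real.rpow_le_rpow_of_exponent_le (by exact_mod_cast hn) ?_
  rw [le_div_iff₀ (by linarith)]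
  linarith

lemma error_bound_le_rate {α M c₁ c₂ χ : ℝ} (hα : 0 < α) (hα1 : α ≤ 1)
    (hc₁ : 0 < c₁) (hc₂ : 0 < c₂) {L n k : ℕ} (hn : 2 ≤ n) (hk : 1 ≤ k)
    (hk₁ : c₁ * (n : ℝ) ^ (1 / (1 + α)) ≤ k) (hk₂ : (k : ℝ) ≤ c₂ * (n : ℝ) ^ (1 / (1 + α)))
    (hχ0 : 0 ≤ χ) (hχ1 : χ < 1) :
    3 * (M * (2 / k) ^ α) ^ 2
        + 8 * ((L + 1) * (1 - χ)⁻¹) ^ 2 * (3 * (k : ℝ) ^ 2 + 7 * (n * Real.log k + 2 * n)) / n ^ 2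
      ≤ rateConstant α M L c₁ c₂
        * ((n : ℝ) ^ (-2 * α / (1 + α)) * ((1 - χ) ^ 2)⁻¹ * Real.log n) := by
  have hn0 : (0 : ℝ) < n := by exact_mod_cast (by omega : 0 < n)
  have hn1 : (1 : ℝ) ≤ n := by exact_mod_cast (by omega : 1 ≤ n)
  have hk0 : (0 : ℝ) < k := by exact_mod_cast hk
  set r := (n : ℝ) ^ (-2 * α / (1 + α)) with hr
  set g := (n : ℝ) ^ (1 / (1 + α)) with hg
  set X := ((1 - χ) ^ 2)⁻¹ with hX
  have hr0 : 0 < r := Real.rpow_pos_of_pos hn0 _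
  have hg0 : 0 < g := Real.rpow_pos_of_pos hn0 _
  have hα1' : 1 + α ≠ 0 := by positivity
  have hX1 : 1 ≤ X := one_le_inv_iff₀.2 ⟨by nlinarith, by nlinarith⟩
  have hlog := one_le_two_mul_log hn
  have hinv := inv_le_rpow_rate hα hα1 (n := n) (by omega)
  -- This and `hgα` are the balance behind the choice of `k`: with `g = n ^ (1 / (1 + α))`, both `g
  -- ^ 2 / n ^ 2` and `g ^ (-2α)` equal the rate `r`.
  have hg2 : g ^ 2 = r * n ^ 2 := by
    rw [hg, hr, ← Real.rpow_natCast, ← Real.rpow_natCast, ← Real.rpow_mul hn0.le,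
      ← Real.rpow_add hn0]
    congr 1
    push_cast
    field_simp
    ring
  have hgα : (g⁻¹ ^ α) ^ 2 = r := by
    rw [hg, hr, ← Real.rpow_neg hn0.le, ← Real.rpow_natCast, ← Real.rpow_mul hn0.le,
      ← Real.rpow_mul hn0.le]
    congr 1
    push_cast
    field_simp
  have hgn : g ≤ n := by
    rw [hg]
    nth_rewrite 2 [← Real.rpow_one (n : ℝ)]
    refine Real.rpow_le_rpow_of_exponent_le hn1 ?_
    rw [div_le_one (by linarith)]
    linarith
  have h1 : (M * (2 / k) ^ α) ^ 2 ≤ M ^ 2 * ((2 / c₁) ^ α) ^ 2 * r := by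
    have : (2 / (k : ℝ)) ^ α ≤ (2 / c₁) ^ α * g⁻¹ ^ α := by
      rw [← Real.mul_rpow (by positivity) (by positivity)]
      gcongr
      rw [← div_eq_mul_inv, div_div]
      gcongr
    rw [mul_pow, mul_assoc]
    gcongr
    calc ((2 / (k : ℝ)) ^ α) ^ 2 ≤ ((2 / c₁) ^ α * g⁻¹ ^ α) ^ 2 := by gcongr
      _ = ((2 / c₁) ^ α) ^ 2 * r := by rw [mul_pow, hgα]
  have h2 : (k : ℝ) ^ 2 / n ^ 2 ≤ c₂ ^ 2 * r := by
    rw [div_le_iff₀ (by positivity), mul_assoc, ← hg2, ← mul_pow]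
    gcongr
  have hc0 : 0 ≤ Real.log (1 + c₂) := Real.log_nonneg (by linarith)
  have h3 : Real.log k ≤ Real.log (1 + c₂) + Real.log n := by
    rw [← Real.log_mul (by linarith) hn0.ne']
    refine Real.log_le_log hk0 (hk₂.trans ?_)
    gcongr
    linarith
  have h4 : (n * Real.log k + 2 * n) / (n : ℝ) ^ 2 ≤ r * (Real.log (1 + c₂) + Real.log n + 2) := by
    have : (n * Real.log k + 2 * n) / (n : ℝ) ^ 2 = (n : ℝ)⁻¹ * (Real.log k + 2) := by
      field_simp
    rw [this]
    have hk1 : 0 ≤ Real.log k := Real.log_natCast_nonneg k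
    gcongr
  have hsq : ((L + 1 : ℝ) * (1 - χ)⁻¹) ^ 2 = (L + 1) ^ 2 * X := by
    rw [mul_pow, inv_pow]
  have hsplit : 8 * ((L + 1) * (1 - χ)⁻¹) ^ 2 * (3 * (k : ℝ) ^ 2 + 7 * (n * Real.log k + 2 * n))
        / n ^ 2
      = 8 * (L + 1) ^ 2 * X * (3 * ((k : ℝ) ^ 2 / n ^ 2)
        + 7 * ((n * Real.log k + 2 * n) / (n : ℝ) ^ 2)) := by
    rw [hsq]; ring
  rw [hsplit]
  set ℓ := Real.log n with hℓ
  have b1 : 3 * (M * (2 / k) ^ α) ^ 2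
      ≤ 6 * M ^ 2 * ((2 / c₁) ^ α) ^ 2 * (r * X * ℓ) := by
    have hXl : 1 ≤ X * (2 * ℓ) := one_le_mul_of_one_le_of_one_le hX1 hlog
    calc 3 * (M * (2 / k) ^ α) ^ 2 ≤ 3 * (M ^ 2 * ((2 / c₁) ^ α) ^ 2 * r) * 1 := by linarith
      _ ≤ 3 * (M ^ 2 * ((2 / c₁) ^ α) ^ 2 * r) * (X * (2 * ℓ)) := by gcongr
      _ = _ := by ring
  -- Terms without a logarithm are multiplied by `2 * ℓ ≥ 1`. This gives `6 = 3 * 2`, `14 = 7 * 2`,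
  -- and `35 = 7 * (1 + 4)` from `log n + 2`.
  have b2 : 3 * ((k : ℝ) ^ 2 / n ^ 2) + 7 * ((n * Real.log k + 2 * n) / (n : ℝ) ^ 2)
      ≤ (6 * c₂ ^ 2 + 14 * Real.log (1 + c₂) + 35) * (r * ℓ) := by
    have m1 : c₂ ^ 2 * r * 1 ≤ c₂ ^ 2 * r * (2 * ℓ) := by gcongr
    have m2 : r * Real.log (1 + c₂) * 1 ≤ r * Real.log (1 + c₂) * (2 * ℓ) := by gcongr
    have m3 : r * 1 ≤ r * (2 * ℓ) := by gcongr
    nlinarith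
  have b3 : 8 * (L + 1) ^ 2 * X * (3 * ((k : ℝ) ^ 2 / n ^ 2)
        + 7 * ((n * Real.log k + 2 * n) / (n : ℝ) ^ 2))
      ≤ 8 * (L + 1) ^ 2 * X * ((6 * c₂ ^ 2 + 14 * Real.log (1 + c₂) + 35) * (r * ℓ)) := by
    gcongr
  calc _ ≤ 6 * M ^ 2 * ((2 / c₁) ^ α) ^ 2 * (r * X * ℓ)
        + 8 * (L + 1) ^ 2 * X * ((6 * c₂ ^ 2 + 14 * Real.log (1 + c₂) + 35) * (r * ℓ)) :=
        add_le_add b1 b3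
    _ = _ := by rw [rateConstant]; ring

lemma dependenceParameter_mem_Ico {l : ℕ} {α' : ℝ} (h0 : 0 < α') (h1 : 1 ≤ l → α' ≤ 1 / 2) :
    dependenceParameter l α' ∈ Set.Ico (0 : ℝ) 1 := by
  unfold dependenceParameter
  split_ifs with hl
  · simp
  · have hl' : 1 ≤ l := Nat.one_le_iff_ne_zero.2 hl
    have h2 := h1 hl'
    exact ⟨Real.rpow_nonneg (by linarith) _,
      Real.rpow_lt_one (by linarith) (by linarith) (by positivity)⟩

/-- Since `χ ^ l = 1 - 2α'` and `χ ^ l ≤ χ`, one has `1 - χ ≤ 2α'`. Using `L + 1` instead of `L`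
lets the same constant serve for `l = 0`, where `K = 1` is needed. -/
lemma div_le_of_dependenceParameter {l L : ℕ} {α' : ℝ} (hl : 1 ≤ l) (hlL : l ≤ L) (h0 : 0 < α')
    (h1 : α' ≤ 1 / 2) :
    (l : ℝ) / (2 * α') ≤ (L + 1) * (1 - dependenceParameter l α')⁻¹ := by
  obtain ⟨hχ0, hχ1⟩ := dependenceParameter_mem_Ico h0 fun _ => h1
  have hpow : dependenceParameter l α' ^ l = 1 - 2 * α' := by
    rw [dependenceParameter, if_neg (by omega), one_div,
      Real.rpow_inv_natCast_pow (by linarith) (by omega)]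
  have hle : dependenceParameter l α' ^ l ≤ dependenceParameter l α' :=
    pow_le_of_le_one hχ0 hχ1.le (by omega)
  rw [div_eq_mul_inv]
  have : (l : ℝ) ≤ L := by exact_mod_cast hlL
  have hpos : 0 < 1 - dependenceParameter l α' := by linarith
  gcongr <;> linarith

/-! ### Uniform control of the edge noise -/

section Model

variable {Ω : Type*} [mΩ : MeasurableSpace Ω] {P : Measure Ω} [IsProbabilityMeasure P] {n : ℕ}
  {ξ : Fin n → Ω → I} {A : Sym2 (Fin n) → Ω → Bool} {ord : NodePair n ≃ Fin (n.choose 2)}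
  {l : ℕ} {α' : ℝ} {f : I → I → ℝ}

namespace IsCompositeGraphonModel

lemma le_half (h : IsCompositeGraphonModel P ξ A ord l α' f) (hn : 2 ≤ n) (hl : 1 ≤ l) :
    α' ≤ 1 / 2 := by
  obtain ⟨ω, h1, h2⟩ := (h.ae_isMemoryChain.and h.ae_blockLowerBound).exists
  exact h1.le_half hl (Nat.choose_pos hn) h2

/-- Given the latent variables, linear forms of the edge variables are sub-Gaussian. -/
lemma ae_sum_mul_exp_le (h : IsCompositeGraphonModel P ξ A ord l α' f)
    (hf : ∀ x y, f x y = f y x) (hn : 2 ≤ n) {L : ℕ} (hlL : l ≤ L) :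
    ∀ᵐ ω ∂P, ∀ w : NodePair n → ℝ,
      ∑ b, condPathProb P ξ (orderedEdge A ord) ω b * Real.exp (∑ e, w e *
          (pathValue (ord e) b - connectionValue f hf (fun i => ξ i ω) e.1))
        ≤ Real.exp (((L + 1) * (1 - dependenceParameter l α')⁻¹) ^ 2 * (∑ e, w e ^ 2) / 2) := by
  filter_upwards [h.ae_isMemoryChain, h.ae_blockLowerBound, h.ae_sum_mul_pathValue hf]
    with ω h1 h2 h3 w
  have e1 : ∀ b, ∑ e, w e * (pathValue (ord e) b - connectionValue f hf (fun i => ξ i ω) e.1)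
      = ∑ t, w (ord.symm t) *
        (pathValue t b - connectionValue f hf (fun i => ξ i ω) (ord.symm t).1) := by
    intro b
    rw [← Equiv.sum_comp ord]
    simp
  have e2 : ∑ e, w e ^ 2 = ∑ t, w (ord.symm t) ^ 2 := (Equiv.sum_comp ord.symm _).symm
  simp_rw [e1, e2]
  rcases Nat.eq_zero_or_pos l with rfl | hl
  · refine (h1.sum_mul_exp_le_of_memory_zero (fun t => w (ord.symm t)) _ h3).trans ?_
    have : dependenceParameter 0 α' = 0 := by simp [dependenceParameter]
    rw [this]
    gcongr
    simp
  · refine (h1.sum_mul_exp_le_of_blockLowerBound hl h.bound_pos (h.le_half hn hl) h2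
      (fun t => w (ord.symm t)) _ h3).trans ?_
    have h4 := div_le_of_dependenceParameter hl hlL h.bound_pos (h.le_half hn hl)
    have h5 : 0 ≤ (l : ℝ) / (2 * α') := by have := h.bound_pos; positivity
    gcongr

/-- The noise is under control, with high probability, uniformly over the assignments of the nodes
to blocks. -/
lemma measureReal_not_noiseBounded_le (h : IsCompositeGraphonModel P ξ A ord l α' f)
    (hf : ∀ x y, f x y = f y x) (hc : Continuous fun p : I × I => f p.1 p.2) (hn : 2 ≤ n) {L : ℕ}
    (hlL : l ≤ L) {k : ℕ} (hk : 1 ≤ k) (η : (Fin n → Fin k) → NodePair n → ℝ) :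
    P.real {ω | ¬ NoiseBounded pairLabel η ((L + 1) * (1 - dependenceParameter l α')⁻¹)
        (n * Real.log k + 2 * n) (fun e => connectionValue f hf (fun i => ξ i ω) e.1)
        (edgeValue fun e => A e ω)}
      ≤ Real.exp (-n) := by
  have hχ := dependenceParameter_mem_Ico h.bound_pos (h.le_half hn)
  set K : ℝ := (L + 1) * (1 - dependenceParameter l α')⁻¹ with hKdef
  have hK : 0 < K := mul_pos (by positivity) (inv_pos.2 (by linarith [hχ.2]))
  set t : ℝ := n * Real.log k + 2 * n with ht
  set D : (Fin (n.choose 2) → Bool) → Set Ω := fun b =>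
    {ω | ¬ NoiseBounded pairLabel η K t (fun e => connectionValue f hf (fun i => ξ i ω) e.1)
      fun e => pathValue (ord e) b} with hD
  have hDm : ∀ b, MeasurableSet[latentSigma ξ] (D b) := by
    intro b
    have hm : Measurable fun (x : Fin n → I) (e : NodePair n) => connectionValue f hf x e.1 :=
      measurable_pi_lambda _ fun e => measurable_connectionValue hf hc e.1
    rw [latentSigma_eq_comap]
    exact ⟨_, (hm (measurableSet_noiseBounded pairLabel η K t
      fun e => pathValue (ord e) b)).compl, rfl⟩
  have hset : {ω | ¬ NoiseBounded pairLabel η K t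
      (fun e => connectionValue f hf (fun i => ξ i ω) e.1) (edgeValue fun e => A e ω)}
      = {ω | ω ∈ D (pathOf (orderedEdge A ord) ω)} := by
    ext ω
    have : (edgeValue fun e => A e ω)
        = fun e : NodePair n => pathValue (ord e) (pathOf (orderedEdge A ord) ω) := by
      ext e
      simp [edgeValue, pathValue, pathOf, orderedEdge]
    simp only [hD, Set.mem_ofPred_eq, this]
  rw [hset]
  refine measureReal_path_mem_le h.measurable_latent h.measurable_orderedEdge hDm ?_
  filter_upwards [h.ae_isMemoryChain, h.ae_sum_mul_exp_le hf hn hlL] with ω h1 h2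
  refine (pathProb_not_noiseBounded_le h1.nonneg hK h2 pairLabel η t).trans ?_
  have hk0 : (0 : ℝ) < k := by exact_mod_cast hk
  have hcard : (Fintype.card (Fin n → Fin k) : ℝ) = Real.exp (n * Real.log k) := by
    rw [Real.exp_nat_mul, Real.exp_log hk0]
    simp
  -- The term `n log k` in `t` cancels the number of labellings. Of the remaining `exp (-2n)`, one
  -- factor `exp (-n)` absorbs the `3` of the three families, as `3 ≤ n + 1 ≤ exp n`.
  rw [hcard, mul_assoc, ← Real.exp_add, ht,
    show (n : ℝ) * Real.log k + -(n * Real.log k + 2 * n) = -n + -n by ring, Real.exp_add,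
    ← mul_assoc]
  refine mul_le_of_le_one_left (Real.exp_pos _).le ?_
  rw [Real.exp_neg, mul_inv_le_iff₀ (Real.exp_pos _), one_mul]
  have hn' : (2 : ℝ) ≤ n := by exact_mod_cast hn
  linarith [Real.add_one_le_exp (n : ℝ)]

end IsCompositeGraphonModel

end Model

/-! ### Deterministic error bounds for the estimate -/

section Estimate

variable {n k : ℕ} {f : I → I → ℝ} {a : Sym2 (Fin n) → Bool} {θ : Matrix (Fin n) (Fin n) ℝ}

lemma IsLeastSquaresEstimate.exists_normalizedError_eq (h : IsLeastSquaresEstimate k a θ)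
    (hf : ∀ x y, f x y = f y x) (x : Fin n → I) :
    ∃ z : Fin n → Fin k,
      normalizedError θ (connectionMatrix f x) = 2 / (n : ℝ) ^ 2 * ∑ e,
        (blockAverage (pairLabel z) (edgeValue a) e - connectionValue f hf x e.1) ^ 2 ∧
      ∀ (z' : Fin n → Fin k) (g : Sym2 (Fin k) → ℝ),
        ∑ e, (edgeValue a e - blockAverage (pairLabel z) (edgeValue a) e) ^ 2
          ≤ ∑ e, (edgeValue a e - g (pairLabel z' e)) ^ 2 := by
  classical
  obtain ⟨z, hdiag, hoff, hmin⟩ := exists_blockAverage_of_isLeastSquaresEstimate h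
  refine ⟨z, ?_, hmin⟩
  rw [normalizedError_eq_sum_nodePair (x := fun e => if he : e.IsDiag then 0 else
      blockAverage (pairLabel z) (edgeValue a) ⟨e, he⟩) (y := connectionValue f hf x)]
  · congr 1
    refine Finset.sum_congr rfl fun e _ => ?_
    simp [e.2]
  · intro i j hij
    have he : ¬ (s(i, j) : Sym2 (Fin n)).IsDiag := by simpa using hij
    simp only [he, dif_neg, not_false_iff]
    exact hoff i j he
  · intro i j hij
    simp [connectionMatrix, hij, connectionValue]
  · intro i
    simp [connectionMatrix, hdiag]

lemma card_nodePair_le (n : ℕ) : (Fintype.card (NodePair n) : ℝ) ≤ (n : ℝ) ^ 2 / 2 := by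
  have h1 : Fintype.card (NodePair n) = n.choose 2 := by
    have := Sym2.card_subtype_not_diag (α := Fin n)
    rw [Fintype.card_fin] at this
    rw [← this]
  rw [h1, Nat.cast_choose_two]
  have : (0 : ℝ) ≤ n := by positivity
  nlinarith

lemma normalizedError_nonneg (θ η : Matrix (Fin n) (Fin n) ℝ) : 0 ≤ normalizedError θ η := by
  unfold normalizedError
  exact mul_nonneg (by positivity)
    (Finset.sum_nonneg fun _ _ => Finset.sum_nonneg fun _ _ => sq_nonneg _)

/-- The estimate averages zeros and ones, so it lies in `[0, 1]` off the diagonal without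
truncation. This is what makes the bad event harmless in expectation. -/
lemma IsLeastSquaresEstimate.normalizedError_le_one (h : IsLeastSquaresEstimate k a θ)
    (hf : ∀ x y, f x y = f y x) (hf1 : ∀ x y, 0 ≤ f x y ∧ f x y ≤ 1) (x : Fin n → I) :
    normalizedError θ (connectionMatrix f x) ≤ 1 := by
  obtain ⟨z, he, -⟩ := h.exists_normalizedError_eq hf x
  rw [he]
  have h1 : ∀ e : NodePair n,
      (blockAverage (pairLabel z) (edgeValue a) e - connectionValue f hf x e.1) ^ 2 ≤ 1 := by
    intro e
    have b1 := blockAverage_mem_Icc (pairLabel z) (x := edgeValue a)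
      (fun e => by unfold edgeValue; split_ifs <;> simp) e
    have b2 : 0 ≤ connectionValue f hf x e.1 ∧ connectionValue f hf x e.1 ≤ 1 := by
      induction e.1 with | _ i j => exact hf1 _ _
    rw [sq_le_one_iff_abs_le_one, abs_le]
    constructor <;> linarith [b1.1, b1.2, b2.1, b2.2]
  rcases Nat.eq_zero_or_pos n with rfl | hn
  · simp
  have hn' : (0 : ℝ) < n := by exact_mod_cast hn
  calc _ ≤ 2 / (n : ℝ) ^ 2 * ∑ _e : NodePair n, (1 : ℝ) := by
        gcongr with e; exact h1 e
    _ = 2 / (n : ℝ) ^ 2 * Fintype.card (NodePair n) := by simp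
    _ ≤ 2 / (n : ℝ) ^ 2 * ((n : ℝ) ^ 2 / 2) := by gcongr; exact card_nodePair_le n
    _ = 1 := by field_simp

lemma card_sym2_fin_le (k : ℕ) : (Fintype.card (Sym2 (Fin k)) : ℝ) ≤ (k : ℝ) ^ 2 := by
  rw [Sym2.card, Fintype.card_fin, Nat.cast_choose_two]
  push_cast
  rcases Nat.eq_zero_or_pos k with rfl | hk
  · simp
  · have : (1 : ℝ) ≤ k := by exact_mod_cast hk
    nlinarith

/-- The error of the least-squares estimate on the event that the noise is under control. -/
lemma IsLeastSquaresEstimate.normalizedError_le (h : IsLeastSquaresEstimate k a θ)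
    {α M K t : ℝ} (hα : 0 < α) (hM : 0 < M) (hf : f ∈ holderClass α M) (hk : 1 ≤ k)
    {x : Fin n → I} (hnoise : NoiseBounded pairLabel
      (fun (z : Fin n → Fin k) e => connectionValue f hf.1 gridPoint (pairLabel z e)) K t
      (fun e => connectionValue f hf.1 x e.1) (edgeValue a)) (hn : 1 ≤ n) :
    normalizedError θ (connectionMatrix f x)
      ≤ 3 * (M * (2 / k) ^ α) ^ 2 + 8 * K ^ 2 * (3 * (k : ℝ) ^ 2 + 7 * t) / n ^ 2 := by
  obtain ⟨z, he, hmin⟩ := h.exists_normalizedError_eq hf.1 x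
  obtain ⟨z', hz'⟩ := exists_abs_connectionValue_sub_le hα hM hf hk x
  have h1 := hnoise.sum_sq_sub_le (hmin z' (connectionValue f hf.1 gridPoint))
  have h2 : ∑ e : NodePair n, (connectionValue f hf.1 x e.1
      - connectionValue f hf.1 gridPoint (pairLabel z' e)) ^ 2
      ≤ (n : ℝ) ^ 2 / 2 * (M * (2 / k) ^ α) ^ 2 := by
    calc _ ≤ ∑ _e : NodePair n, (M * (2 / k) ^ α) ^ 2 := by
          refine Finset.sum_le_sum fun e _ => ?_
          rw [← sq_abs]
          exact pow_le_pow_left₀ (abs_nonneg _) (hz' e) 2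
      _ = Fintype.card (NodePair n) * (M * (2 / k) ^ α) ^ 2 := by simp
      _ ≤ _ := by gcongr; exact card_nodePair_le n
  have h3 := card_sym2_fin_le k
  have hn' : (0 : ℝ) < n := by exact_mod_cast hn
  rw [he]
  calc _ ≤ 2 / (n : ℝ) ^ 2 * (3 * ((n : ℝ) ^ 2 / 2 * (M * (2 / k) ^ α) ^ 2)
        + 4 * K ^ 2 * (3 * (k : ℝ) ^ 2 + 7 * t)) := by
        gcongr
        refine h1.trans ?_
        gcongr
    _ = _ := by
        field_simp
        ring

end Estimate

/-! ### Passage to the expectation and conclusion -/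

lemma integral_le_add_measureReal {Ω : Type*} [MeasurableSpace Ω] {P : Measure Ω}
    [IsProbabilityMeasure P] {X : Ω → ℝ} (hX : Measurable X) (h0 : ∀ ω, 0 ≤ X ω)
    (h1 : ∀ ω, X ω ≤ 1) {R : ℝ} (hR : 0 ≤ R) :
    Integrable X P ∧ ∫ ω, X ω ∂P ≤ R + (1 - P.real {ω | X ω ≤ R}) := by
  have hint : Integrable X P := Integrable.of_bound hX.aestronglyMeasurable 1
    (Filter.Eventually.of_forall fun ω => by
      rw [Real.norm_eq_abs, abs_of_nonneg (h0 ω)]; exact h1 ω)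
  have hm : MeasurableSet {ω | X ω ≤ R} := measurableSet_le hX measurable_const
  refine ⟨hint, ?_⟩
  rw [← probReal_compl_eq_one_sub hm]
  calc ∫ ω, X ω ∂P ≤ ∫ ω, (R + {ω | X ω ≤ R}ᶜ.indicator (fun _ => (1 : ℝ)) ω) ∂P := by
        refine integral_mono hint ((integrable_const R).add
          ((integrable_const (1 : ℝ)).indicator hm.compl)) fun ω => ?_
        by_cases hω : X ω ≤ R
        · simp [hω]
        · have := h1 ω
          simp [hω]
          linarith
    _ = R + P.real {ω | X ω ≤ R}ᶜ := by
        rw [integral_add (integrable_const R) ((integrable_const (1 : ℝ)).indicator hm.compl),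
          integral_indicator hm.compl]
        simp

lemma measurable_normalizedError {Ω : Type*} [MeasurableSpace Ω] {n : ℕ} {f : I → I → ℝ}
    (hc : Continuous fun p : I × I => f p.1 p.2) {ξ : Fin n → Ω → I} (hξ : ∀ i, Measurable (ξ i))
    {θ : Ω → Matrix (Fin n) (Fin n) ℝ} (hθ : ∀ i j, Measurable fun ω => θ ω i j) :
    Measurable fun ω => normalizedError (θ ω) (connectionMatrix f fun i => ξ i ω) := by
  unfold normalizedError
  refine (Finset.measurable_sum _ fun i _ => Finset.measurable_sum _ fun j _ =>
    ((hθ i j).sub ?_).pow_const 2).const_mul _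
  unfold connectionMatrix
  by_cases hij : i = j
  · simp [hij]
  · simp only [hij, if_false]
    exact hc.measurable.comp (f := fun ω => (ξ i ω, ξ j ω)) ((hξ i).prodMk (hξ j))

theorem theorem2 (α M : ℝ) (hα : 0 < α) (hα1 : α ≤ 1) (hM : 0 < M)
    (L : ℕ) (c₁ c₂ : ℝ) (hc₁ : 0 < c₁) (hc₂ : 0 < c₂) :
    ∃ C > 0, ∃ C' > 0, ∃ C₁ > 0,
      ∀ (n k l : ℕ), 1 ≤ n → l ≤ L →
      c₁ * (n : ℝ) ^ (1 / (1 + min α 1)) ≤ (k : ℝ) →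
      (k : ℝ) ≤ c₂ * (n : ℝ) ^ (1 / (1 + min α 1)) →
      ∀ f ∈ boundedHolderClass α M,
      ∀ (Ω : Type*) [MeasurableSpace Ω] (P : Measure Ω) [IsProbabilityMeasure P]
        (ξ : Fin n → Ω → I) (A : Sym2 (Fin n) → Ω → Bool)
        (ord : NodePair n ≃ Fin (n.choose 2)) (α' : ℝ),
      IsCompositeGraphonModel P ξ A ord l α' f →
      ∀ θhat : Ω → Matrix (Fin n) (Fin n) ℝ,
      (∀ i j, Measurable fun ω => θhat ω i j) →
      (∀ ω, IsLeastSquaresEstimate k (fun e => A e ω) (θhat ω)) →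
        1 - Real.exp (-C' * n) ≤
          P.real {ω | normalizedError (θhat ω) (connectionMatrix f fun i => ξ i ω) ≤
            C * graphonRate α (dependenceParameter l α') n} ∧
        Integrable
          (fun ω => normalizedError (θhat ω) (connectionMatrix f fun i => ξ i ω)) P ∧
        ∫ ω, normalizedError (θhat ω) (connectionMatrix f fun i => ξ i ω) ∂P ≤
          C₁ * graphonRate α (dependenceParameter l α') n := by
  have hmin : min α 1 = α := min_eq_left hα1
  have hC : 0 < rateConstant α M L c₁ c₂ := by
    have := Real.log_nonneg (by linarith : 1 ≤ 1 + c₂)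
    unfold rateConstant
    positivity
  -- The extra `2` in the constant for the mean pays for the bad event: `exp (-n) ≤ 1 / n`, which is
  -- at most twice the rate.
  refine ⟨rateConstant α M L c₁ c₂, hC, 1, one_pos, rateConstant α M L c₁ c₂ + 2, by linarith, ?_⟩
  intro n k l hn hlL hk₁ hk₂ f hf Ω _ P _ ξ A ord α' hmodel θhat hθm hθ
  obtain ⟨hfH, hf01⟩ := hf
  have hc := continuous_of_mem_holderClass hα hM hfH
  have hn0 : (0 : ℝ) < n := by exact_mod_cast hn
  rw [hmin] at hk₁ hk₂
  have hk : 1 ≤ k := by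
    have : (0 : ℝ) < k := (mul_pos hc₁ (Real.rpow_pos_of_pos hn0 _)).trans_le hk₁
    exact_mod_cast this
  set X : Ω → ℝ := fun ω => normalizedError (θhat ω) (connectionMatrix f fun i => ξ i ω) with hX
  have hXm : Measurable X := measurable_normalizedError hc hmodel.measurable_latent hθm
  have hX0 : ∀ ω, 0 ≤ X ω := fun ω => normalizedError_nonneg _ _
  rcases hn.eq_or_lt with rfl | hn2
  -- For `n = 1` the rate vanishes because `log 1 = 0`, but there are no pairs and the error
  -- vanishes as well.
  · have hXz : X = fun _ => 0 := by
      ext ω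
      obtain ⟨Q, z, -, -, hQ⟩ := hθ ω
      simp [hX, normalizedError, connectionMatrix, hQ, Subsingleton.elim _ (0 : Fin 1)]
    have hrate : graphonRate α (dependenceParameter l α') 1 = 0 := by simp [graphonRate]
    change _ ≤ P.real {ω | X ω ≤ _} ∧ Integrable X P ∧ ∫ ω, X ω ∂P ≤ _
    rw [hrate, hXz]
    simp [Real.exp_nonneg]
  have hn2 : 2 ≤ n := hn2
  obtain ⟨hχ0, hχ1⟩ := dependenceParameter_mem_Ico hmodel.bound_pos (hmodel.le_half hn2)
  have hrate : graphonRate α (dependenceParameter l α') n = (n : ℝ) ^ (-2 * α / (1 + α))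
      * ((1 - dependenceParameter l α') ^ 2)⁻¹ * Real.log n := by
    rw [graphonRate, hmin]
  have hbound := error_bound_le_rate (M := M) (L := L) hα hα1 hc₁ hc₂ hn2 hk hk₁ hk₂ hχ0 hχ1
  rw [← hrate] at hbound
  have hinv : (n : ℝ)⁻¹ ≤ 2 * graphonRate α (dependenceParameter l α') n := by
    have h1 : 1 ≤ ((1 - dependenceParameter l α') ^ 2)⁻¹ :=
      one_le_inv_iff₀.2 ⟨by nlinarith, by nlinarith⟩
    have h2 := one_le_mul_of_one_le_of_one_le h1 (one_le_two_mul_log hn2)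
    have h3 := inv_le_rpow_rate hα hα1 hn
    have h4 : 0 ≤ (n : ℝ) ^ (-2 * α / (1 + α)) := by positivity
    rw [hrate]
    nlinarith [mul_le_mul_of_nonneg_left h2 h4]
  have hprob : 1 - Real.exp (-1 * n) ≤ P.real {ω | X ω ≤
      rateConstant α M L c₁ c₂ * graphonRate α (dependenceParameter l α') n} := by
    have hbad := hmodel.measureReal_not_noiseBounded_le hfH.1 hc hn2 hlL hk
      fun z e => connectionValue f hfH.1 gridPoint (pairLabel z e)
    rw [neg_one_mul, sub_le_iff_le_add]
    refine le_trans ?_ (add_le_add_right hbad _)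
    refine le_trans ?_ (measureReal_union_le _ _)
    -- The whole space is covered by the good event of the estimate and the bad event of the noise;
    -- subadditivity gives the bound without measurability of the latter.
    refine (probReal_univ (μ := P)).ge.trans (measureReal_mono fun ω _ => ?_)
    by_cases hω : NoiseBounded pairLabel
        (fun (z : Fin n → Fin k) e => connectionValue f hfH.1 gridPoint (pairLabel z e))
        ((L + 1) * (1 - dependenceParameter l α')⁻¹) (n * Real.log k + 2 * n)
        (fun e => connectionValue f hfH.1 (fun i => ξ i ω) e.1) (edgeValue fun e => A e ω)
    · exact .inl (((hθ ω).normalizedError_le hα hM hfH hk hω hn).trans hbound)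
    · exact .inr hω
  have hR : 0 ≤ rateConstant α M L c₁ c₂ * graphonRate α (dependenceParameter l α') n := by
    have : (0 : ℝ) ≤ (n : ℝ)⁻¹ := by positivity
    exact mul_nonneg hC.le (by linarith)
  obtain ⟨hint, hexp⟩ := integral_le_add_measureReal (P := P) hXm hX0
    (fun ω => (hθ ω).normalizedError_le_one hfH.1 hf01 _) hR
  refine ⟨hprob, hint, hexp.trans ?_⟩
  have hexp' : Real.exp (-1 * n) ≤ (n : ℝ)⁻¹ := by
    rw [neg_one_mul, Real.exp_neg]
    refine inv_anti₀ hn0 ?_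
    linarith [Real.add_one_le_exp (n : ℝ)]
  rw [add_mul]
  linarith
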